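/- Let $d\ge 1$, let $\mathbf{e}_1,\dots,\mathbf{e}_d$ be the standard basis of $\mathbb{Z}^d$, and let $\mathbf{X}=(X,\Sigma,\mu,T)$ be a $\mathbb{Z}^d$-system, i.e. an action $T:\mathbb{Z}^d\curvearrowright(X,\Sigma,\mu)$ by measure-preserving transformations of a standard Borel probability space. Definitions. For a subgroup $\Lambda\le\mathbb{Z}^d$ let $\Sigma^{T\upharpoonright\Lambda}$ be the $\sigma$-algebra of all $A\in\Sigma$ with $\mu(A\,\triangle\, T^{-\gamma}A)=0$ for all $\gamma\in\Lambda$; for $e\subseteq\{1,\dots,d\}$ with $|e|\ge2$ let $\Phi_e:=\Sigma^{T\upharpoonright\Lambda_e}$, where $\Lambda_e$ is the subgroup generated by $\{\mathbf{e}_a-\mathbf{e}_b: a,b\in e\}$, and write $\Sigma^{T^{\mathbf{e}_i}=T^{\mathbf{e}_j}}:=\Sigma^{T\upharpoonright\mathbb{Z}(\mathbf{e}_i-\mathbf{e}_j)}$. Let $\Phi_{\langle i\rangle}:=\bigvee_{e\ni i,\,|e|\ge2}\Phi_e$. A factor map $\pi:\mathbf{Y}\to\mathbf{Z}$ of $\mathbb{Z}^d$-systems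 is an equivariant measurable map carrying the measure of $\mathbf{Y}$ to that of $\mathbf{Z}$; $\mathbf{Y}$ is then an extension of $\mathbf{Z}$. Let $\mathsf{Z}_0^{\mathbf{e}_i-\mathbf{e}_j}$ be the class of all $\mathbb{Z}^d$-systems on which $\mathbb{Z}(\mathbf{e}_i-\mathbf{e}_j)$ acts trivially almost everywhere. The join of a finite family of classes is the class of all systems admitting factor maps, one to a member of each class, that together generate the whole $\sigma$-algebra modulo negligible sets. The maximal $\mathsf{C}$-factor of a system is the $\sigma$-subalgebra, unique up to negligible sets, that is generated by a factor map to a member of $\mathsf{C}$ and contains, up to negligible sets, every other $\sigma$-subalgebra so generated. For a probability measure $\nu$, a finite tuple of $\sigma$-subalgebras $(\Sigma_i)_i$ is relatively independent over $(\Xi_i)_i$ under $\nu$ if $\int\prod_i f_i\,d\nu=\int\prod_i\mathsf{E}_\nu(f_i\mid\Xi_i)\,d\nu$ whenever each $f_i\in L^\infty(\nu)$ is real-valued and $\Sigma_i$-measurable. The system $\mathbf{X}$ is $\mathsf{C}$-sated if for every extension $\pi:\tilde{\mathbf{X}}\to\mathbf{X}$, the pair consisting of $\pi^{-1}(\Sigma)$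 and the maximal $\mathsf{C}$-factor of $\tilde{\mathbf{X}}$ is relatively independent over $(\pi^{-1}(\Xi),\pi^{-1}(\Xi))$ under the measure of $\tilde{\mathbf{X}}$, where $\Xi$ is the maximal $\mathsf{C}$-factor of $\mathbf{X}$. The Furstenberg self-joining of $\mathbf{X}$ is the probability measure $\mu^{\mathrm{F}}$ on $X^d$ with $$\mu^{\mathrm{F}}(A_1\times\cdots\times A_d)=\lim_{N\to\infty}\frac1N\sum_{n=1}^N\mu\big(T^{-n\mathbf{e}_1}(A_1)\cap\cdots\cap T^{-n\mathbf{e}_d}(A_d)\big)\qquad\text{for all }A_1,\dots,A_d\in\Sigma.$$ Proposition. For $i\le d$ let $\mathsf{C}_i:=\bigvee_{j\le d,\,j\ne i}\mathsf{Z}_0^{\mathbf{e}_i-\mathbf{e}_j}$, and suppose that $\mathbf{X}$ is $\mathsf{C}_i$-sated for every $i\le d$. Then the Furstenberg self-joining $\mu^{\mathrm{F}}$ exists (all the limits above exist and define a unique probability measure on $X^d$), and, writing $\pi_i:X^d\to X$ for the coordinate projections, the tuple $(\pi_1^{-1}(\Sigma),\dots,\pi_d^{-1}(\Sigma))$ is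 relatively independent under $\mu^{\mathrm{F}}$ over the tuple of factors $$\pi_i^{-1}\Big(\bigvee_{j\le d,\,j\ne i}\Sigma^{T^{\mathbf{e}_i}=T^{\mathbf{e}_j}}\Big)=\pi_i^{-1}(\Phi_{\langle i\rangle}),\qquad i=1,\dots,d.$$ -/

import Mathlib

open MeasureTheory Filter Topology

universe u

noncomputable section

namespace Satedness

/-- A `Γ`-system: an action of the discrete abelian group `Γ` by measure-preserving
transformations on a standard Borel probability space. -/
structure PPSystem (Γ : Type) [AddCommGroup Γ] where
  /-- The underlying space. -/
  carrier : Type u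
  [measurableSpace : MeasurableSpace carrier]
  [standardBorel : StandardBorelSpace carrier]
  /-- The invariant measure. -/
  μ : Measure carrier
  [isProbabilityMeasure : IsProbabilityMeasure μ]
  /-- The action: `T γ` is the transformation `T^γ`. -/
  T : Γ → carrier → carrier
  T_zero : T 0 = id
  T_add : ∀ γ δ, T (γ + δ) = T γ ∘ T δ
  measurePreserving : ∀ γ, MeasurePreserving (T γ) μ μ

attribute [instance] PPSystem.measurableSpace PPSystem.standardBorel
  PPSystem.isProbabilityMeasure

/-- Inclusion of σ-algebras up to `μ`-negligible sets. -/
def LEModNull {α : Type u} {m₀ : MeasurableSpace α} (μ : Measure α) (m₁ m₂ : MeasurableSpace α) :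
    Prop :=
  ∀ A : Set α, MeasurableSet[m₁] A → ∃ B : Set α, MeasurableSet[m₂] B ∧ A =ᵐ[μ] B

/-- The tuple of σ-subalgebras `m` is relatively independent over the tuple `Ξ` under `μ`. -/
def RelIndep {ι : Type} [Fintype ι] {α : Type u} {m₀ : MeasurableSpace α} (μ : Measure α)
    (m Ξ : ι → MeasurableSpace α) : Prop :=
  ∀ f : ι → α → ℝ, (∀ i, StronglyMeasurable[m i] (f i)) → (∀ i, MemLp (f i) ⊤ μ) →
    ∫ x, ∏ i, f i x ∂μ = ∫ x, ∏ i, (μ[f i | Ξ i]) x ∂μ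

section Systems

variable {Γ : Type} [AddCommGroup Γ]

/-- `π` is a factor map `X → Y`; equivalently, `X` is an extension of `Y` through `π`. -/
structure IsFactorMap (X Y : PPSystem.{u} Γ) (π : X.carrier → Y.carrier) : Prop where
  measurePreserving : MeasurePreserving π X.μ Y.μ
  equivariant : ∀ γ, Y.T γ ∘ π = π ∘ X.T γ

/-- The σ-subalgebra of `X` generated by a map `π` to the space of `Y`. -/
@[reducible]
def factorAlgebra (X Y : PPSystem.{u} Γ) (π : X.carrier → Y.carrier) :
    MeasurableSpace X.carrier :=
  MeasurableSpace.comap π Y.measurableSpace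

/-- The class `Z_0^Λ` of all systems on which the subaction of `Λ` is trivial (almost surely). -/
def ZZero (Λ : AddSubgroup Γ) : Set (PPSystem.{u} Γ) :=
  {X | ∀ γ ∈ Λ, X.T γ =ᵐ[X.μ] id}

/-- The join of a family of classes: all joinings of members of the classes, i.e. all systems
having factor maps to members of the classes which together generate, up to negligible sets,
the whole σ-algebra. -/
def joinClass {ι : Type} (C : ι → Set (PPSystem.{u} Γ)) : Set (PPSystem.{u} Γ) :=
  {X | ∃ (Y : ι → PPSystem.{u} Γ) (π : ∀ j, X.carrier → (Y j).carrier),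
    (∀ j, Y j ∈ C j) ∧ (∀ j, IsFactorMap X (Y j) (π j)) ∧
    LEModNull X.μ X.measurableSpace (⨆ j, factorAlgebra X (Y j) (π j))}

/-- `Ξ` is a `C`-factor of `X`: it is generated by a factor map to a member of `C`. -/
def IsClassFactor (C : Set (PPSystem.{u} Γ)) (X : PPSystem.{u} Γ)
    (Ξ : MeasurableSpace X.carrier) : Prop :=
  ∃ (Y : PPSystem.{u} Γ) (ζ : X.carrier → Y.carrier),
    Y ∈ C ∧ IsFactorMap X Y ζ ∧ Ξ = factorAlgebra X Y ζ

/-- `Ξ` is a maximal `C`-factor of `X`: a `C`-factor containing, up to negligible sets, every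
other `C`-factor (so it is unique up to negligible sets). -/
def IsMaximalClassFactor (C : Set (PPSystem.{u} Γ)) (X : PPSystem.{u} Γ)
    (Ξ : MeasurableSpace X.carrier) : Prop :=
  IsClassFactor C X Ξ ∧ ∀ Ξ', IsClassFactor C X Ξ' → LEModNull X.μ Ξ' Ξ

/-- `X` is `C`-sated: for every extension `π : X' → X`, the factor map `π` and the maximal
`C`-factor of `X'` are relatively independent over the lift through `π` of the maximal `C`-factor
of `X`. The maximal factors are arbitrary choices in their class modulo negligible sets. -/
def IsSated (C : Set (PPSystem.{u} Γ)) (X : PPSystem.{u} Γ) : Prop :=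
  ∀ (X' : PPSystem.{u} Γ) (π : X'.carrier → X.carrier), IsFactorMap X' X π →
    ∀ (Ξ' : MeasurableSpace X'.carrier) (Ξ : MeasurableSpace X.carrier),
      IsMaximalClassFactor C X' Ξ' → IsMaximalClassFactor C X Ξ →
        RelIndep X'.μ ![factorAlgebra X' X π, Ξ']
          ![MeasurableSpace.comap π Ξ, MeasurableSpace.comap π Ξ]

/-- The partially invariant factor `Σ^{T↾Λ}`: the σ-algebra of the measurable sets which are
`T^γ`-invariant up to negligible sets for all `γ ∈ Λ`. -/
@[reducible]
def invariantFactor (X : PPSystem.{u} Γ) (Λ : AddSubgroup Γ) : MeasurableSpace X.carrier where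
  MeasurableSet' A := MeasurableSet A ∧ ∀ γ ∈ Λ, X.T γ ⁻¹' A =ᵐ[X.μ] A
  measurableSet_empty := ⟨MeasurableSet.empty, fun _ _ => by simp⟩
  measurableSet_compl A hA :=
    ⟨hA.1.compl, fun γ hγ => by
      rw [Set.preimage_compl]
      exact (hA.2 γ hγ).compl⟩
  measurableSet_iUnion A hA :=
    ⟨MeasurableSet.iUnion fun n => (hA n).1, fun γ hγ => by
      rw [Set.preimage_iUnion]
      exact Filter.EventuallyEq.countable_iUnion fun n => (hA n).2 γ hγ⟩

end Systems

section Furstenberg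

variable {d : ℕ}

/-- The standard basis vector `e_i` of `ℤ^d`. -/
def stdVec (i : Fin d) : Fin d → ℤ := Pi.single i 1

/-- The subgroup `ℤ(e_i - e_j)` of `ℤ^d`. -/
def diffSubgroup (i j : Fin d) : AddSubgroup (Fin d → ℤ) :=
  AddSubgroup.zmultiples (stdVec i - stdVec j)

/-- The class `C_i`, the join over `j ≠ i` of the classes `Z_0^{e_i - e_j}`. -/
def classC (i : Fin d) : Set (PPSystem.{u} (Fin d → ℤ)) :=
  joinClass fun j : {j : Fin d // j ≠ i} => ZZero (diffSubgroup i j)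

/-- The factor `Φ_e = Σ^{T^{e_{i_1}} = ... = T^{e_{i_k}}}` for `e = {i_1, ..., i_k}`. -/
@[reducible]
def Phi (X : PPSystem.{u} (Fin d → ℤ)) (e : Finset (Fin d)) : MeasurableSpace X.carrier :=
  invariantFactor X (AddSubgroup.closure {v | ∃ a ∈ e, ∃ b ∈ e, v = stdVec a - stdVec b})

/-- The factor `Φ_⟨i⟩`, the join of all `Φ_e` with `i ∈ e` and `|e| ≥ 2`. -/
@[reducible]
def PhiPrincipal (X : PPSystem.{u} (Fin d → ℤ)) (i : Fin d) : MeasurableSpace X.carrier :=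
  ⨆ e : {e : Finset (Fin d) // 2 ≤ e.card ∧ i ∈ e}, Phi X e

/-- The join over `j ≠ i` of the factors `Σ^{T^{e_i} = T^{e_j}}`. -/
@[reducible]
def pairJoin (X : PPSystem.{u} (Fin d → ℤ)) (i : Fin d) : MeasurableSpace X.carrier :=
  ⨆ j : {j : Fin d // j ≠ i}, invariantFactor X (diffSubgroup i j)

/-- `ν` is the Furstenberg self-joining of `X`: the probability measure on `X^d` whose value on
every measurable box `A_1 × ... × A_d` is the limit of the averages
`(1/N) ∑_{n=1}^N μ(T^{-n e_1}(A_1) ∩ ... ∩ T^{-n e_d}(A_d))`. -/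
structure IsFurstenbergSelfJoining (X : PPSystem.{u} (Fin d → ℤ))
    (ν : Measure (Fin d → X.carrier)) : Prop where
  isProbabilityMeasure : IsProbabilityMeasure ν
  tendsto_box : ∀ A : Fin d → Set X.carrier, (∀ i, MeasurableSet (A i)) →
    Tendsto (fun N : ℕ => (1 / (N : ℝ)) *
        ∑ n ∈ Finset.Icc 1 N, X.μ.real (⋂ i, X.T ((n : ℤ) • stdVec i) ⁻¹' A i))
      atTop (𝓝 (ν.real (Set.univ.pi A)))

/-- The σ-subalgebra `π_i⁻¹(m)` of `X^d` for the `i`-th coordinate projection. -/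
@[reducible]
def coordAlgebra (X : PPSystem.{u} (Fin d → ℤ)) (i : Fin d) (m : MeasurableSpace X.carrier) :
    MeasurableSpace (Fin d → X.carrier) :=
  MeasurableSpace.comap (fun x : Fin d → X.carrier => x i) m

end Furstenberg

end Satedness

end

/-!
# Relative independence of the Furstenberg self-joining of a sated system

The self-joining `μF` exists for every `ℤ^d`-system. Indeed the averages of
`∏ i, f i ∘ T^{n e_i}` converge in `L²` (Tao's theorem), so the empirical joinings converge on
boxes; as all their marginals are `μ`, they are tight, and a weak limit has the limiting values on
boxes because boxes can be approximated by open and closed boxes uniformly over all joinings of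
`μ` (`exists_measure_of_tendsto_pi`).

The convergence is proved by induction on the number of functions, in the spirit of Walsh. Let
`P_n` be the product of the terms with index in `s`, and add one function `a` translated by `h^n`.
In the Hilbert space of the state, consider the vectors along which the operators
`avg_{n < N} P_n ρ(h^n)` converge. A vector orthogonal to all of them whose averages do not tend to
`0` correlates with a weak limit of the dual functions `avg_{n < N} ρ(h^{-n}) (P_n b_N)`. But
averaging such a limit along `h` turns, by shifting `n`, into an average over `s` alone
(`tendsto_φ_mul_avgOp_dualFn`), for functions `f_i ρ(h^{-n} g_i^n) f_i` which depend on the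
parameter `n`; it converges by induction (`cauchyNrm_avgOp`). To treat all parameters at once, the
induction runs over all commutative algebras with an invariant positive functional
(`StateSystem`), a class closed under passing to bounded arrays with a limit of averages along an
ultrafilter as functional; no countable additivity is involved.

For the relative independence, view `μF` as an extension of `X` through the coordinate `i`, letting
`e_i` act by `T^{e_1} × ⋯ × T^{e_d}` and `e_j`, `j ≠ i`, act diagonally (`liftSystem`). Then
`e_i - e_j` acts trivially on the coordinate `j`, so all coordinates other than `i` are measurable
with respect to the maximal `C_i`-factor of the extension. Satedness says precisely that the
coordinate `i` is independent of this factor relative to the maximal `C_i`-factor of `X`, which is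
the join of the factors `Σ^{T^{e_i} = T^{e_j}}` modulo null sets
(`exists_isMaximalClassFactor_join`). Hence each function may be replaced by its conditional
expectation (`integral_mul_prod_eq_zero`), one coordinate at a time.
-/

universe v

/-! ### Commutative systems carrying a state -/

/-- A commutative algebraic model of a measure-preserving action: a commutative real algebra `𝒜`
with a positive functional `φ` (the integral), on which the commutative group `G` acts by
`φ`-preserving algebra endomorphisms. The field `bdd` says that every element acts by
multiplication as a bounded operator for the seminorm `√φ(b²)`. No countable additivity is
required, which makes the notion stable under limits along ultrafilters. -/
structure StateSystem (G : Type) [CommGroup G] (𝒜 : Type v) [CommRing 𝒜] [Algebra ℝ 𝒜] where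
  /-- The positive functional. -/
  φ : 𝒜 →ₗ[ℝ] ℝ
  /-- The action. -/
  ρ : G →* (𝒜 →ₐ[ℝ] 𝒜)
  nonneg : ∀ a, 0 ≤ φ (a * a)
  invariant : ∀ g a, φ (ρ g a) = φ a
  bdd : ∀ a, ∃ C : ℝ, 0 ≤ C ∧ ∀ b, φ ((a * b) * (a * b)) ≤ C ^ 2 * φ (b * b)

namespace StateSystem

variable {G : Type} [CommGroup G] {𝒜 : Type v} [CommRing 𝒜] [Algebra ℝ 𝒜]

/-- The Gelfand–Naimark–Segal construction: `𝒜` with the seminorm of `φ` maps densely to a Hilbert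
space. -/
theorem exists_gns (S : StateSystem G 𝒜) :
    ∃ (H : Type v) (_ : NormedAddCommGroup H) (_ : InnerProductSpace ℝ H) (_ : CompleteSpace H)
      (ι : 𝒜 →ₗ[ℝ] H), DenseRange ι ∧ ∀ a b, inner ℝ (ι a) (ι b) = S.φ (a * b) := by
  let c : PreInnerProductSpace.Core ℝ 𝒜 :=
    { inner := fun a b => S.φ (a * b)
      conj_inner_symm := fun a b => by simp [mul_comm]
      re_inner_nonneg := fun a => by simpa using S.nonneg a
      add_left := fun a b z => by simp [add_mul]
      smul_left := fun a b r => by simp }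
  let : SeminormedAddCommGroup 𝒜 := InnerProductSpace.Core.toSeminormedAddCommGroup (c := c)
  let : InnerProductSpace ℝ 𝒜 := InnerProductSpace.ofCore c
  refine ⟨UniformSpace.Completion 𝒜, inferInstance, inferInstance, inferInstance,
    (UniformSpace.Completion.toComplL (𝕜 := ℝ) (E := 𝒜)).toLinearMap, ?_, ?_⟩
  · exact UniformSpace.Completion.denseRange_coe
  · intro a b
    exact UniformSpace.Completion.inner_coe a b

/-- The seminorm `√φ(a²)`, the `L²` seminorm of the state. -/
noncomputable def nrm (S : StateSystem G 𝒜) (a : 𝒜) : ℝ := √(S.φ (a * a))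

/-- `a` acts by multiplication with operator norm at most `C`, i.e. `|a| ≤ C`. -/
def BddBy (S : StateSystem G 𝒜) (C : ℝ) (a : 𝒜) : Prop :=
  0 ≤ C ∧ ∀ b, S.nrm (a * b) ≤ C * S.nrm b

section Seminorm

variable (S : StateSystem G 𝒜)

theorem nrm_sq (a : 𝒜) : S.nrm a ^ 2 = S.φ (a * a) := Real.sq_sqrt (S.nonneg a)

theorem nrm_nonneg (a : 𝒜) : 0 ≤ S.nrm a := Real.sqrt_nonneg _

theorem nrm_eq_norm {H : Type*} [NormedAddCommGroup H] [InnerProductSpace ℝ H] {ι : 𝒜 →ₗ[ℝ] H}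
    (hι : ∀ a b, inner ℝ (ι a) (ι b) = S.φ (a * b)) (a : 𝒜) : ‖ι a‖ = S.nrm a := by
  rw [nrm, ← hι, real_inner_self_eq_norm_sq, Real.sqrt_sq (norm_nonneg _)]

theorem nrm_add_le (a b : 𝒜) : S.nrm (a + b) ≤ S.nrm a + S.nrm b := by
  obtain ⟨H, _, _, _, ι, -, hι⟩ := S.exists_gns
  simp only [← S.nrm_eq_norm hι, map_add]
  exact norm_add_le _ _

theorem nrm_smul (c : ℝ) (a : 𝒜) : S.nrm (c • a) = |c| * S.nrm a := by
  obtain ⟨H, _, _, _, ι, -, hι⟩ := S.exists_gns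
  simp only [← S.nrm_eq_norm hι, map_smul, norm_smul, Real.norm_eq_abs]

theorem nrm_zero : S.nrm 0 = 0 := by simp [nrm]

theorem abs_φ_mul_le (a b : 𝒜) : |S.φ (a * b)| ≤ S.nrm a * S.nrm b := by
  obtain ⟨H, _, _, _, ι, -, hι⟩ := S.exists_gns
  rw [← hι, ← S.nrm_eq_norm hι, ← S.nrm_eq_norm hι]
  exact abs_real_inner_le_norm _ _

theorem nrm_sum_le {κ : Type*} (s : Finset κ) (f : κ → 𝒜) :
    S.nrm (∑ i ∈ s, f i) ≤ ∑ i ∈ s, S.nrm (f i) := by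
  obtain ⟨H, _, _, _, ι, -, hι⟩ := S.exists_gns
  simp only [← S.nrm_eq_norm hι, map_sum]
  exact norm_sum_le _ _

theorem nrm_ρ (g : G) (a : 𝒜) : S.nrm (S.ρ g a) = S.nrm a := by
  rw [nrm, ← map_mul, S.invariant, nrm]

theorem ρ_mul_apply (g h : G) (a : 𝒜) : S.ρ (g * h) a = S.ρ g (S.ρ h a) := by
  rw [map_mul]; rfl

theorem ρ_one_apply (a : 𝒜) : S.ρ 1 a = a := by
  rw [map_one]; rfl

end Seminorm

section BddBy

variable {S : StateSystem G 𝒜} {C D : ℝ} {a b : 𝒜}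

theorem BddBy.nrm_le (h : S.BddBy C a) : S.nrm a ≤ C * S.nrm 1 := by
  simpa using h.2 1

theorem bddBy_iff : S.BddBy C a ↔ 0 ≤ C ∧ ∀ b, S.φ ((a * b) * (a * b)) ≤ C ^ 2 * S.φ (b * b) := by
  refine and_congr_right fun hC => forall_congr' fun b => ?_
  rw [← S.nrm_sq, ← S.nrm_sq, ← mul_pow]
  exact (pow_le_pow_iff_left₀ (S.nrm_nonneg _) (mul_nonneg hC (S.nrm_nonneg _)) two_ne_zero).symm

variable (S) in
theorem exists_bddBy (a : 𝒜) : ∃ C, S.BddBy C a := by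
  obtain ⟨C, h0, h⟩ := S.bdd a
  exact ⟨C, bddBy_iff.2 ⟨h0, h⟩⟩

theorem BddBy.mul (ha : S.BddBy C a) (hb : S.BddBy D b) : S.BddBy (C * D) (a * b) := by
  refine ⟨mul_nonneg ha.1 hb.1, fun x => ?_⟩
  rw [mul_assoc, mul_assoc]
  exact (ha.2 _).trans (mul_le_mul_of_nonneg_left (hb.2 x) ha.1)

theorem BddBy.add (ha : S.BddBy C a) (hb : S.BddBy D b) : S.BddBy (C + D) (a + b) := by
  refine ⟨add_nonneg ha.1 hb.1, fun x => ?_⟩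
  rw [add_mul, add_mul]
  exact (S.nrm_add_le _ _).trans (add_le_add (ha.2 x) (hb.2 x))

theorem BddBy.smul (c : ℝ) (ha : S.BddBy C a) : S.BddBy (|c| * C) (c • a) := by
  refine ⟨mul_nonneg (abs_nonneg _) ha.1, fun x => ?_⟩
  rw [smul_mul_assoc, S.nrm_smul, mul_assoc]
  exact mul_le_mul_of_nonneg_left (ha.2 x) (abs_nonneg _)

variable (S) in
theorem bddBy_one : S.BddBy 1 1 := ⟨zero_le_one, fun b => by simp⟩

variable (S) in
theorem bddBy_algebraMap (c : ℝ) : S.BddBy |c| (algebraMap ℝ 𝒜 c) := by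
  rw [Algebra.algebraMap_eq_smul_one]
  simpa using (bddBy_one S).smul c

theorem BddBy.prod {κ : Type*} {s : Finset κ} {C : κ → ℝ} {f : κ → 𝒜}
    (h : ∀ i ∈ s, S.BddBy (C i) (f i)) : S.BddBy (∏ i ∈ s, C i) (∏ i ∈ s, f i) := by
  classical
  induction s using Finset.induction_on with
  | empty => simpa using S.bddBy_one
  | insert i s hi ih =>
    rw [Finset.prod_insert hi, Finset.prod_insert hi]
    exact (h i (by simp)).mul (ih fun k hk => h k (by simp [hk]))

theorem BddBy.ρ (ha : S.BddBy C a) (g : G) : S.BddBy C (S.ρ g a) := by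
  refine ⟨ha.1, fun x => ?_⟩
  have hx : x = S.ρ g (S.ρ g⁻¹ x) := by rw [← ρ_mul_apply, mul_inv_cancel, ρ_one_apply]
  rw [hx, ← map_mul, S.nrm_ρ, S.nrm_ρ]
  exact ha.2 _

end BddBy

/-! ### Averages -/

/-- The average `(1/N) ∑_{n < N} u n`. -/
noncomputable def avg {M : Type*} [AddCommGroup M] [Module ℝ M] (N : ℕ) (u : ℕ → M) : M :=
  (N : ℝ)⁻¹ • ∑ n ∈ Finset.range N, u n

section Avg

variable {M M' : Type*} [AddCommGroup M] [Module ℝ M] [AddCommGroup M'] [Module ℝ M']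

theorem map_avg (L : M →ₗ[ℝ] M') (N : ℕ) (u : ℕ → M) :
    L (avg N u) = avg N fun n => L (u n) := by
  simp [avg, map_sum]

theorem avg_add (N : ℕ) (u w : ℕ → M) : avg N (fun n => u n + w n) = avg N u + avg N w := by
  simp [avg, Finset.sum_add_distrib]

theorem avg_smul (N : ℕ) (c : ℝ) (u : ℕ → M) : avg N (fun n => c • u n) = c • avg N u := by
  rw [avg, ← Finset.smul_sum, smul_comm, avg]

theorem mul_avg (a : 𝒜) (N : ℕ) (u : ℕ → 𝒜) : a * avg N u = avg N fun n => a * u n := by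
  rw [avg, avg, mul_smul_comm, Finset.mul_sum]

theorem avg_const {N : ℕ} (hN : N ≠ 0) (c : ℝ) : avg N (fun _ => c) = c := by
  simp [avg, hN]

theorem avg_mono {N : ℕ} {u w : ℕ → ℝ} (h : ∀ n, u n ≤ w n) : avg N u ≤ avg N w :=
  mul_le_mul_of_nonneg_left (Finset.sum_le_sum fun n _ => h n) (by positivity)

theorem avg_le_of_forall_le {N : ℕ} {u : ℕ → ℝ} {C : ℝ} (hC : 0 ≤ C) (h : ∀ n, u n ≤ C) :
    avg N u ≤ C := by
  rcases eq_or_ne N 0 with rfl | hN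
  · simpa [avg] using hC
  · exact (avg_mono h).trans (avg_const hN C).le

theorem abs_avg_le {N : ℕ} {u : ℕ → ℝ} {C : ℝ} (hC : 0 ≤ C) (h : ∀ n, |u n| ≤ C) :
    |avg N u| ≤ C := by
  refine abs_le'.2 ⟨avg_le_of_forall_le hC fun n => (le_abs_self _).trans (h n), ?_⟩
  have : -avg N u = avg N fun n => -u n := by simpa using (avg_smul N (-1 : ℝ) u).symm
  rw [this]
  exact avg_le_of_forall_le hC fun n => (neg_le_abs _).trans (h n)

theorem nrm_avg_le (S : StateSystem G 𝒜) (N : ℕ) (u : ℕ → 𝒜) :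
    S.nrm (avg N u) ≤ avg N fun n => S.nrm (u n) := by
  rw [avg, S.nrm_smul, abs_of_nonneg (by positivity)]
  exact mul_le_mul_of_nonneg_left (S.nrm_sum_le _ _) (by positivity)

theorem BddBy.avg {S : StateSystem G 𝒜} {C : ℝ} (hC : 0 ≤ C) {u : ℕ → 𝒜}
    (h : ∀ n, S.BddBy C (u n)) (N : ℕ) : S.BddBy C (avg N u) := by
  refine ⟨hC, fun x => ?_⟩
  rw [mul_comm, mul_avg]
  refine (nrm_avg_le S N _).trans (avg_le_of_forall_le (mul_nonneg hC (S.nrm_nonneg _)) fun n => ?_)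
  rw [mul_comm]
  exact (h n).2 x

/-- Averages over `[0, N)` and over `[l, N + l)` differ by at most `2 l` boundary terms. -/
theorem nrm_avg_shift_sub_le (S : StateSystem G 𝒜) {D : ℝ} (u : ℕ → 𝒜)
    (hu : ∀ n, S.nrm (u n) ≤ D) (N l : ℕ) :
    S.nrm (StateSystem.avg N (fun n => u (n + l)) - StateSystem.avg N u) ≤
      (N : ℝ)⁻¹ * (2 * l * D) := by
  have hD : 0 ≤ D := (S.nrm_nonneg _).trans (hu 0)
  induction l with
  | zero => simp [S.nrm_zero]
  | succ l ih =>
    have h1 : StateSystem.avg N (fun n => u (n + (l + 1))) - StateSystem.avg N u =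
        (StateSystem.avg N (fun n => u (n + l)) - StateSystem.avg N u) +
          (N : ℝ)⁻¹ • (u (N + l) + (-1 : ℝ) • u l) := by
      have h2 := Finset.sum_range_succ' (fun n => u (n + l)) N
      rw [Finset.sum_range_succ] at h2
      have h3 : ∑ n ∈ Finset.range N, u (n + (l + 1)) =
          ∑ n ∈ Finset.range N, u (n + l) + (u (N + l) + (-1 : ℝ) • u l) := by
        have : ∀ n, n + (l + 1) = n + 1 + l := fun n => by ring
        simp only [this]
        rw [eq_sub_of_add_eq h2.symm]
        simp only [zero_add, neg_smul, one_smul]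
        abel
      rw [StateSystem.avg, h3, smul_add, StateSystem.avg, StateSystem.avg]
      abel
    rw [h1]
    refine (S.nrm_add_le _ _).trans ?_
    rw [S.nrm_smul, abs_of_nonneg (by positivity)]
    have h4 : S.nrm (u (N + l) + (-1 : ℝ) • u l) ≤ 2 * D := by
      refine (S.nrm_add_le _ _).trans ?_
      rw [S.nrm_smul]
      have := hu (N + l); have := hu l
      norm_num
      linarith
    have h5 := mul_le_mul_of_nonneg_left h4 (by positivity : (0 : ℝ) ≤ (N : ℝ)⁻¹)
    push_cast
    nlinarith
end Avg

end StateSystem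

/-! ### Bounded arrays and ultrafilter limits of averages -/

namespace StateSystem

variable {G : Type} [CommGroup G] {𝒜 : Type v} [CommRing 𝒜] [Algebra ℝ 𝒜]

/-- A bounded sequence of reals converges along every ultrafilter. -/
theorem tendsto_limUnder_of_abs_le {p : Ultrafilter ℕ} {x : ℕ → ℝ} {C : ℝ} (h : ∀ N, |x N| ≤ C) :
    Tendsto x p (𝓝 (limUnder p x)) := by
  have hK : IsCompact (Set.Icc (-C) C) := isCompact_Icc
  obtain ⟨y, -, hy⟩ := hK.ultrafilter_le_nhds' (p.map x)
    (by
      rw [Ultrafilter.mem_map]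
      exact Filter.univ_mem' fun N => abs_le.1 (h N))
  exact tendsto_nhds_limUnder ⟨y, hy⟩

/-- The algebra of arrays `F N n` of elements of `𝒜` that are uniformly bounded multipliers. -/
def bddArray (S : StateSystem G 𝒜) : Subalgebra ℝ (ℕ → ℕ → 𝒜) where
  carrier := {F | ∃ C, ∀ N n, S.BddBy C (F N n)}
  mul_mem' := by
    rintro F F' ⟨C, hC⟩ ⟨D, hD⟩
    exact ⟨C * D, fun N n => (hC N n).mul (hD N n)⟩
  add_mem' := by
    rintro F F' ⟨C, hC⟩ ⟨D, hD⟩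
    exact ⟨C + D, fun N n => (hC N n).add (hD N n)⟩
  algebraMap_mem' c := ⟨|c|, fun _ _ => S.bddBy_algebraMap c⟩

variable (S : StateSystem G 𝒜)

theorem exists_abs_φ_le (F : S.bddArray) : ∃ C, 0 ≤ C ∧ ∀ N n, |S.φ (F.1 N n)| ≤ C := by
  obtain ⟨C, hC⟩ := F.2
  refine ⟨C * S.nrm 1 * S.nrm 1, ?_, fun N n => ?_⟩
  · exact mul_nonneg (mul_nonneg (hC 0 0).1 (S.nrm_nonneg _)) (S.nrm_nonneg _)
  · have := S.abs_φ_mul_le (F.1 N n) 1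
    rw [mul_one] at this
    exact this.trans (mul_le_mul_of_nonneg_right (hC N n).nrm_le (S.nrm_nonneg _))

theorem tendsto_avg_φ (p : Ultrafilter ℕ) (F : S.bddArray) :
    Tendsto (fun N => avg N fun n => S.φ (F.1 N n)) p
      (𝓝 (limUnder p fun N => avg N fun n => S.φ (F.1 N n))) := by
  obtain ⟨C, hC, h⟩ := S.exists_abs_φ_le F
  exact tendsto_limUnder_of_abs_le fun N => abs_avg_le hC (h N)

/-- The system of bounded arrays, with state `F ↦ lim_{N → p} (1/N) ∑_{n < N} φ (F N n)` and the
entrywise action. The limit exists since bounded arrays have bounded averages. -/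
noncomputable def arraySystem (p : Ultrafilter ℕ) : StateSystem G S.bddArray where
  φ :=
    { toFun := fun F => limUnder p fun N => avg N fun n => S.φ (F.1 N n)
      map_add' := fun F F' => by
        refine tendsto_nhds_unique (S.tendsto_avg_φ p (F + F')) ?_
        refine ((S.tendsto_avg_φ p F).add (S.tendsto_avg_φ p F')).congr fun N => ?_
        rw [← avg_add]
        simp
      map_smul' := fun c F => by
        refine tendsto_nhds_unique (S.tendsto_avg_φ p (c • F)) ?_
        refine ((S.tendsto_avg_φ p F).const_smul c).congr fun N => ?_
        rw [← avg_smul]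
        simp }
  ρ :=
    { toFun := fun g =>
        { toFun := fun F => ⟨fun N n => S.ρ g (F.1 N n), by
            obtain ⟨C, hC⟩ := F.2
            exact ⟨C, fun N n => (hC N n).ρ g⟩⟩
          map_one' := by ext; simp
          map_mul' := fun F F' => by ext; simp
          map_zero' := by ext; simp
          map_add' := fun F F' => by ext; simp
          commutes' := fun c => by ext; simp [Pi.algebraMap_apply] }
      map_one' := by ext; simp
      map_mul' := fun g h => by ext; simp }
  nonneg F := by
    refine ge_of_tendsto' (S.tendsto_avg_φ p (F * F)) fun N => ?_
    have := avg_mono (N := N) (u := fun _ => 0) (fun n => S.nonneg (F.1 N n))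
    simpa [avg] using! this
  invariant g F := by
    simp only [LinearMap.coe_mk, AddHom.coe_mk, MonoidHom.coe_mk, OneHom.coe_mk, AlgHom.coe_mk,
      RingHom.coe_mk, S.invariant]
  bdd F := by
    obtain ⟨C, hC⟩ := F.2
    refine ⟨C, (hC 0 0).1, fun B => ?_⟩
    refine le_of_tendsto_of_tendsto' (S.tendsto_avg_φ p ((F * B) * (F * B)))
      ((S.tendsto_avg_φ p (B * B)).const_mul (C ^ 2)) fun N => ?_
    rw [← smul_eq_mul (C ^ 2), ← avg_smul]
    exact avg_mono fun n => (bddBy_iff.1 (hC N n)).2 _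

theorem tendsto_arraySystem_φ (p : Ultrafilter ℕ) (F : S.bddArray) :
    Tendsto (fun N => avg N fun n => S.φ (F.1 N n)) p (𝓝 ((S.arraySystem p).φ F)) :=
  S.tendsto_avg_φ p F

/-! ### Norm convergence of multiple averages -/

variable {ι : Type}

/-- The `n`-th term `∏_{i ∈ s} ρ(g_i^n) f_i` of a multiple average. -/
noncomputable def multTerm (s : Finset ι) (g : ι → G) (f : ι → 𝒜) (n : ℕ) : 𝒜 :=
  ∏ i ∈ s, S.ρ (g i ^ n) (f i)

/-- The sequence `u` is Cauchy for the seminorm of the system. -/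
def CauchyNrm (u : ℕ → 𝒜) : Prop :=
  ∀ ε > 0, ∃ N₀, ∀ N ≥ N₀, ∀ N' ≥ N₀, S.nrm (u N - u N') < ε

theorem exists_bddBy_multTerm (s : Finset ι) (g : ι → G) (f : ι → 𝒜) :
    ∃ C, ∀ n, S.BddBy C (S.multTerm s g f n) := by
  choose C hC using fun i => S.exists_bddBy (f i)
  exact ⟨∏ i ∈ s, C i, fun n => BddBy.prod fun i _ => (hC i).ρ _⟩

/-- The differencing identity: multiplying by the term shifted by `n` and translated back by `h^n`
replaces each `f_i` by `f_i ρ(h^{-n} g_i^n) f_i`. -/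
theorem ρ_multTerm_add (s : Finset ι) (g : ι → G) (f : ι → 𝒜) (h : G) (n l : ℕ) :
    S.multTerm s g f l * S.ρ (h⁻¹ ^ n) (S.multTerm s g f (n + l)) =
      S.multTerm s g (fun i => f i * S.ρ (h⁻¹ ^ n * g i ^ n) (f i)) l := by
  simp only [multTerm, map_prod, ← Finset.prod_mul_distrib, map_mul]
  refine Finset.prod_congr rfl fun i _ => ?_
  congr 1
  rw [← map_mul]
  simp only [← ρ_mul_apply]
  congr 2
  rw [pow_add]
  ac_rfl

theorem arraySystem_multTerm_apply (p : Ultrafilter ℕ) (s : Finset ι) (g : ι → G)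
    (F : ι → S.bddArray) (l N n : ℕ) :
    ((S.arraySystem p).multTerm s g F l).1 N n = S.multTerm s g (fun i => (F i).1 N n) l := by
  simp only [multTerm]
  rw [← Subalgebra.val_apply, map_prod, Finset.prod_apply, Finset.prod_apply]
  rfl

end StateSystem

namespace StateSystem

variable {G : Type} [CommGroup G] {𝒜 : Type v} [CommRing 𝒜] [Algebra ℝ 𝒜]
variable {ι : Type}

theorem tendsto_avg {α : Type*} {l : Filter α} (N : ℕ) {x : α → ℕ → ℝ} {y : ℕ → ℝ}
    (h : ∀ n, Tendsto (fun t => x t n) l (𝓝 (y n))) :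
    Tendsto (fun t => avg N (x t)) l (𝓝 (avg N y)) := by
  simp only [avg]
  exact (tendsto_finsetSum _ fun n _ => h n).const_smul _

variable (S : StateSystem G 𝒜)

/-- The weighted averaging operator `a ↦ (1/N) ∑_{n < N} P_n ρ(h^n) a`. -/
noncomputable def avgOp (P : ℕ → 𝒜) (h : G) (N : ℕ) : 𝒜 →ₗ[ℝ] 𝒜 :=
  avg N fun n => LinearMap.mulLeft ℝ (P n) ∘ₗ (S.ρ (h ^ n)).toLinearMap

theorem avgOp_apply (P : ℕ → 𝒜) (h : G) (N : ℕ) (a : 𝒜) :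
    S.avgOp P h N a = avg N fun n => P n * S.ρ (h ^ n) a := by
  simp [avgOp, avg]

/-- The dual functions `(1/N) ∑_{n < N} ρ(h^{-n}) (P_n b_N)`: pairing with them is the adjoint of
applying `avgOp`. -/
noncomputable def dualFn (P : ℕ → 𝒜) (h : G) (b : ℕ → 𝒜) (N : ℕ) : 𝒜 :=
  avg N fun n => S.ρ (h⁻¹ ^ n) (P n * b N)

theorem φ_dualFn_mul (P : ℕ → 𝒜) (h : G) (b : ℕ → 𝒜) (N : ℕ) (c : 𝒜) :
    S.φ (S.dualFn P h b N * c) = S.φ (b N * S.avgOp P h N c) := by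
  rw [avgOp_apply, dualFn, mul_comm, mul_avg, mul_avg, map_avg, map_avg]
  congr 1
  funext n
  rw [← S.invariant (h ^ n), map_mul, ← ρ_mul_apply, ← mul_pow, mul_inv_cancel, one_pow,
    ρ_one_apply]
  congr 1
  ring

/-- The constant array. -/
def constArray (c : 𝒜) : S.bddArray :=
  ⟨fun _ _ => c, (S.exists_bddBy c).imp fun _ hC _ _ => hC⟩

theorem nrm_constArray {p : Ultrafilter ℕ} (hp : (p : Filter ℕ) ≤ atTop) (c : 𝒜) :
    (S.arraySystem p).nrm (S.constArray c) = S.nrm c := by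
  have h := S.tendsto_arraySystem_φ p (S.constArray c * S.constArray c)
  have h2 : Tendsto (fun N => avg N fun n => S.φ ((S.constArray c * S.constArray c).1 N n)) p
      (𝓝 (S.φ (c * c))) := by
    refine tendsto_const_nhds.congr' ?_
    filter_upwards [hp (eventually_ne_atTop 0)] with N hN
    exact (avg_const hN _).symm
  rw [nrm, nrm, tendsto_nhds_unique h h2]

/-- The array `f_i ρ(h^{-n} g_i^n) f_i`, independent of the first index. -/
noncomputable def diffArray (g : ι → G) (f : ι → 𝒜) (h : G) (i : ι) : S.bddArray :=
  ⟨fun _ n => f i * S.ρ (h⁻¹ ^ n * g i ^ n) (f i), by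
    obtain ⟨C, hC⟩ := S.exists_bddBy (f i)
    exact ⟨C * C, fun _ n => hC.mul (hC.ρ _)⟩⟩

/-- Averaging a dual function along `h` produces, in the limit, a multiple average over `s` alone
in the system of arrays. This is where one function is eliminated: shifting the dual function by
`h^l` amounts to replacing `P_n` by `P_{n + l}`, up to boundary terms. -/
theorem tendsto_φ_mul_avgOp_dualFn {p : Ultrafilter ℕ} (hp : (p : Filter ℕ) ≤ atTop)
    (s : Finset ι) (g : ι → G) (f : ι → 𝒜) (h : G) {b : ℕ → 𝒜} {C : ℝ}
    (hb : ∀ N, S.BddBy C (b N)) (w : S.bddArray) (hw : ∀ N n, w.1 N n = S.ρ (h⁻¹ ^ n) (b N))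
    (c : 𝒜) (N' : ℕ) :
    Tendsto (fun N => S.φ (c * S.avgOp (S.multTerm s g f) h N' (S.dualFn (S.multTerm s g f) h b N)))
      p (𝓝 ((S.arraySystem p).φ (S.constArray c *
        (w * avg N' ((S.arraySystem p).multTerm s g (S.diffArray g f h)))))) := by
  set P := S.multTerm s g f with hP
  obtain ⟨CP, hCP⟩ := S.exists_bddBy_multTerm s g f
  rw [mul_avg, mul_avg, map_avg]
  simp only [avgOp_apply, mul_avg, map_avg]
  refine tendsto_avg N' fun l => ?_
  have h1 := S.tendsto_arraySystem_φ p (S.constArray c * (w *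
    (S.arraySystem p).multTerm s g (S.diffArray g f h) l))
  -- the terms of the shifted dual function
  let u : ℕ → ℕ → 𝒜 := fun N n => S.ρ (h ^ l) (S.ρ (h⁻¹ ^ n) (P n * b N))
  have hu : ∀ N n, S.nrm (u N n) ≤ CP * C * S.nrm 1 := fun N n =>
    ((((hCP n).mul (hb N)).ρ _).ρ _).nrm_le
  have h2 : ∀ N, S.φ (c * (P l * S.ρ (h ^ l) (S.dualFn P h b N))) =
      S.φ (c * P l * avg N (u N)) := fun N => by
    rw [dualFn, ← mul_assoc]
    congr 2
    exact map_avg (S.ρ (h ^ l)).toLinearMap N _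
  have h3 : ∀ N, (avg N fun n => S.φ ((S.constArray c * (w *
      (S.arraySystem p).multTerm s g (S.diffArray g f h) l)).1 N n)) =
      S.φ (c * P l * avg N fun n => u N (n + l)) := fun N => by
    rw [mul_avg, map_avg]
    congr 1
    funext n
    congr 1
    have h4 : ((S.arraySystem p).multTerm s g (S.diffArray g f h) l).1 N n =
        P l * S.ρ (h⁻¹ ^ n) (P (n + l)) := by
      rw [arraySystem_multTerm_apply, hP, ρ_multTerm_add]
      rfl
    have h5 : u N (n + l) = S.ρ (h⁻¹ ^ n) (P (n + l)) * S.ρ (h⁻¹ ^ n) (b N) := by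
      simp only [u]
      rw [← ρ_mul_apply, map_mul, pow_add, mul_comm (h⁻¹ ^ n), ← mul_assoc, ← mul_pow,
        mul_inv_cancel, one_pow, one_mul]
    rw [h5]
    change c * (w.1 N n * ((S.arraySystem p).multTerm s g (S.diffArray g f h) l).1 N n) = _
    rw [h4, hw]
    ring
  simp only [h2]
  simp only [h3] at h1
  refine h1.congr_dist ?_
  have h6 : Tendsto (fun N : ℕ => S.nrm (c * P l) * ((N : ℝ)⁻¹ * (2 * l * (CP * C * S.nrm 1))))
      p (𝓝 0) := by
    have : Tendsto (fun N : ℕ => (N : ℝ)⁻¹) p (𝓝 0) :=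
      (tendsto_inv_atTop_nhds_zero_nat (𝕜 := ℝ)).mono_left hp
    simpa using (this.mul_const (2 * l * (CP * C * S.nrm 1))).const_mul (S.nrm (c * P l))
  refine squeeze_zero (fun _ => dist_nonneg) (fun N => ?_) h6
  rw [Real.dist_eq, ← map_sub, ← mul_sub]
  refine (S.abs_φ_mul_le _ _).trans (mul_le_mul_of_nonneg_left ?_ (S.nrm_nonneg _))
  exact S.nrm_avg_shift_sub_le (u N) (hu N) N l

/-- A bounded sequence in a Hilbert space converges weakly along every ultrafilter. -/
theorem exists_weak_limit {H : Type*} [NormedAddCommGroup H] [InnerProductSpace ℝ H]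
    [CompleteSpace H] (p : Ultrafilter ℕ) {x : ℕ → H} {D : ℝ} (hx : ∀ N, ‖x N‖ ≤ D) :
    ∃ z : H, ∀ y, Tendsto (fun N => inner ℝ (x N) y) p (𝓝 (inner ℝ z y)) := by
  have hb : ∀ y N, |inner ℝ (x N) y| ≤ D * ‖y‖ := fun y N =>
    (abs_real_inner_le_norm _ _).trans (mul_le_mul_of_nonneg_right (hx N) (norm_nonneg _))
  have ht : ∀ y, Tendsto (fun N => inner ℝ (x N) y) p
      (𝓝 (limUnder p fun N => inner ℝ (x N) y)) := fun y => tendsto_limUnder_of_abs_le (hb y)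
  let Λ : H →ₗ[ℝ] ℝ :=
    { toFun := fun y => limUnder p fun N => inner ℝ (x N) y
      map_add' := fun y z => by
        refine tendsto_nhds_unique (ht (y + z)) ?_
        simpa only [inner_add_right] using (ht y).add (ht z)
      map_smul' := fun c y => by
        refine tendsto_nhds_unique (ht (c • y)) ?_
        simpa only [inner_smul_right, smul_eq_mul, RingHom.id_apply] using (ht y).const_mul c }
  have hΛ : ∀ y, ‖Λ y‖ ≤ D * ‖y‖ := fun y =>
    le_of_tendsto' (ht y).norm fun N => hb y N
  refine ⟨(InnerProductSpace.toDual ℝ H).symm (Λ.mkContinuous D hΛ), fun y => ?_⟩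
  rw [InnerProductSpace.toDual_symm_apply]
  exact ht y

/-- The vectors along which a uniformly bounded sequence of operators is Cauchy form a closed
subspace. -/
theorem exists_cauchy_submodule {H : Type*} [NormedAddCommGroup H] [InnerProductSpace ℝ H]
    {B : ℕ → H →L[ℝ] H} {C : ℝ} (hB : ∀ N x, ‖B N x‖ ≤ C * ‖x‖) :
    ∃ K : Submodule ℝ H, IsClosed (K : Set H) ∧ ∀ x, x ∈ K ↔ CauchySeq fun N => B N x := by
  let K : Submodule ℝ H :=
    { carrier := {x | CauchySeq fun N => B N x}
      add_mem' := fun {x y} hx hy => by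
        have h : CauchySeq ((fun N => B N x) + fun N => B N y) := CauchySeq.add hx hy
        rwa [show ((fun N => B N x) + fun N => B N y) = fun N => B N (x + y) from
          funext fun N => ((B N).map_add x y).symm] at h
      zero_mem' := by simpa using! cauchySeq_const (0 : H)
      smul_mem' := fun c x hx => by
        have h : CauchySeq fun N => c • B N x :=
          (uniformContinuous_const_smul c).comp_cauchySeq hx
        rwa [show (fun N => c • B N x) = fun N => B N (c • x) from
          funext fun N => ((B N).map_smul c x).symm] at h }
  refine ⟨K, ?_, fun x => Iff.rfl⟩
  refine isClosed_of_closure_subset fun x hx => ?_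
  change CauchySeq fun N => B N x
  rw [Metric.cauchySeq_iff]
  intro ε hε
  have hC : 0 < |C| + 1 := by positivity
  obtain ⟨y, hy, hxy⟩ := Metric.mem_closure_iff.1 hx (ε / 3 / (|C| + 1)) (by positivity)
  obtain ⟨N₀, h₀⟩ := Metric.cauchySeq_iff.1 (show CauchySeq fun N => B N y from hy) (ε / 3)
    (by positivity)
  have key : ∀ N, dist (B N x) (B N y) < ε / 3 := fun N => by
    rw [dist_eq_norm, ← map_sub]
    rw [dist_eq_norm, lt_div_iff₀ hC] at hxy
    refine lt_of_le_of_lt ((hB N _).trans ?_) hxy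
    rw [mul_comm]
    exact mul_le_mul_of_nonneg_left ((le_abs_self C).trans (by linarith)) (norm_nonneg _)
  refine ⟨N₀, fun m hm n hn => ?_⟩
  have := dist_triangle4 (B m x) (B m y) (B n y) (B n x)
  have := key m; have := key n; have := h₀ m hm n hn
  rw [dist_comm (B n y)] at *
  linarith

/-- The inductive step: if multiple averages over `s` converge in every system of arrays over `S`,
then so do the averages with one further function `a`. -/
theorem cauchyNrm_avgOp (s : Finset ι) (g : ι → G) (f : ι → 𝒜) (h : G)
    (ih : ∀ (p : Ultrafilter ℕ) (F : ι → S.bddArray),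
      (S.arraySystem p).CauchyNrm fun N => avg N ((S.arraySystem p).multTerm s g F)) (a : 𝒜) :
    S.CauchyNrm fun N => S.avgOp (S.multTerm s g f) h N a := by
  obtain ⟨H, _, _, _, ι, hd, hι⟩ := S.exists_gns
  have hn := S.nrm_eq_norm hι
  set P := S.multTerm s g f with hP
  obtain ⟨C, hC⟩ := S.exists_bddBy_multTerm s g f
  have hC0 := (hC 0).1
  have hW : ∀ N a, ‖(ι ∘ₗ S.avgOp P h N) a‖ ≤ C * ‖ι a‖ := fun N a => by
    rw [LinearMap.comp_apply, hn, hn, avgOp_apply]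
    refine (nrm_avg_le S N _).trans
      (avg_le_of_forall_le (mul_nonneg hC0 (S.nrm_nonneg _)) fun n => ?_)
    exact ((hC n).2 _).trans_eq (by rw [S.nrm_ρ])
  -- the extensions of the averaging operators to the Hilbert space
  let B : ℕ → H →L[ℝ] H := fun N => (ι ∘ₗ S.avgOp P h N).extendOfNorm ι
  have hBι : ∀ N a, B N (ι a) = ι (S.avgOp P h N a) := fun N a =>
    LinearMap.extendOfNorm_eq hd ⟨C, hW N⟩ a
  have hB : ∀ N x, ‖B N x‖ ≤ C * ‖x‖ := fun N x =>
    LinearMap.norm_extendOfNorm_apply_le hd C (hW N) x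
  obtain ⟨K, hKc, hK⟩ := exists_cauchy_submodule hB
  have hKcomplete : CompleteSpace K := hKc.completeSpace_coe
  suffices hKtop : K = ⊤ by
    have h1 : ι a ∈ K := by rw [hKtop]; trivial
    rw [hK, Metric.cauchySeq_iff] at h1
    intro ε hε
    obtain ⟨N₀, h₀⟩ := h1 ε hε
    refine ⟨N₀, fun N hN N' hN' => ?_⟩
    have := h₀ N hN N' hN'
    rwa [dist_eq_norm, hBι, hBι, ← map_sub, hn] at this
  rw [← Submodule.orthogonal_eq_bot_iff, Submodule.eq_bot_iff]
  intro x hx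
  suffices hx0 : Tendsto (fun N => B N x) atTop (𝓝 0) by
    have h1 : x ∈ K := (hK x).2 hx0.cauchySeq
    exact inner_self_eq_zero.1 ((Submodule.mem_orthogonal K x).1 hx x h1)
  by_contra hnot
  -- an ultrafilter along which the averages of `x` stay away from `0`
  obtain ⟨ε, hε, hfreq⟩ : ∃ ε > 0, ∃ᶠ N in atTop, ε ≤ ‖B N x‖ := by
    rw [tendsto_zero_iff_norm_tendsto_zero, Metric.tendsto_nhds] at hnot
    push Not at hnot
    obtain ⟨ε, hε, h1⟩ := hnot
    refine ⟨ε, hε, fun h2 => h1 ?_⟩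
    filter_upwards [h2] with N hN
    simpa using hN
  have hne : (atTop ⊓ 𝓟 {N | ε ≤ ‖B N x‖}).NeBot := frequently_mem_iff_neBot.1 hfreq
  let p : Ultrafilter ℕ := Ultrafilter.of (atTop ⊓ 𝓟 {N | ε ≤ ‖B N x‖})
  have hp0 : (p : Filter ℕ) ≤ atTop ⊓ 𝓟 {N | ε ≤ ‖B N x‖} := Ultrafilter.of_le _
  have hp : (p : Filter ℕ) ≤ atTop := hp0.trans inf_le_left
  have hpε : ∀ᶠ N in p, ε ≤ ‖B N x‖ := le_principal_iff.1 (hp0.trans inf_le_right)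
  -- approximate `x` by a bounded element and form the dual functions of its averages
  obtain ⟨c, hc⟩ := hd.exists_dist_lt x
    (show 0 < ε ^ 2 / (2 * (C * C * ‖x‖ + 1)) by positivity)
  obtain ⟨D, hD⟩ := S.exists_bddBy c
  let b : ℕ → 𝒜 := fun N => S.avgOp P h N c
  have hb : ∀ N, S.BddBy (C * D) (b N) := fun N => by
    simp only [b, avgOp_apply]
    exact BddBy.avg (mul_nonneg hC0 hD.1) (fun n => (hC n).mul (hD.ρ _)) N
  let σ : ℕ → 𝒜 := S.dualFn P h b
  have hσ : ∀ N, S.BddBy (C * (C * D)) (σ N) := fun N =>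
    BddBy.avg (mul_nonneg hC0 (hb 0).1) (fun n => ((hC n).mul (hb N)).ρ _) N
  have hσB : ∀ N y, inner ℝ (ι (σ N)) y = inner ℝ (ι (b N)) (B N y) := fun N y => by
    refine hd.induction_on (p := fun y => inner ℝ (ι (σ N)) y = inner ℝ (ι (b N)) (B N y)) y
      (isClosed_eq (by fun_prop) (by fun_prop)) fun c' => ?_
    rw [hBι, hι, hι]
    exact S.φ_dualFn_mul P h b N c'
  obtain ⟨z, hz⟩ := exists_weak_limit (x := fun N => ι (σ N)) (D := C * (C * D) * S.nrm 1) p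
    fun N => by rw [hn]; exact (hσ N).nrm_le
  -- the weak limit correlates with `x`
  have hzx : ε ^ 2 / 2 ≤ inner ℝ z x := by
    refine ge_of_tendsto (hz x) ?_
    filter_upwards [hpε] with N hN
    have h1 : ι (b N) = B N x - B N (x - ι c) := by
      rw [map_sub, sub_sub_cancel, hBι]
    rw [hσB, h1, inner_sub_left, real_inner_self_eq_norm_sq]
    have h2 : inner ℝ (B N (x - ι c)) (B N x) ≤ ε ^ 2 / 2 := by
      have h3 : 0 < 2 * (C * C * ‖x‖ + 1) := by positivity
      rw [dist_eq_norm, lt_div_iff₀ h3] at hc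
      have h4 := (real_inner_le_norm (B N (x - ι c)) (B N x)).trans
        (mul_le_mul (hB N _) (hB N x) (norm_nonneg _) (mul_nonneg hC0 (norm_nonneg _)))
      nlinarith [norm_nonneg (x - ι c)]
    have h5 : ε ^ 2 ≤ ‖B N x‖ ^ 2 := pow_le_pow_left₀ hε.le hN 2
    linarith
  -- and it belongs to the subspace of convergence
  have hzK : z ∈ K := by
    rw [hK, Metric.cauchySeq_iff]
    let w : S.bddArray := ⟨fun N n => S.ρ (h⁻¹ ^ n) (b N), C * D, fun N n => (hb N).ρ _⟩
    obtain ⟨E, hE⟩ := (S.arraySystem p).exists_bddBy w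
    let A : ℕ → S.bddArray := fun N => avg N ((S.arraySystem p).multTerm s g (S.diffArray g f h))
    have hBz : ∀ N' c', inner ℝ (B N' z) (ι c') =
        (S.arraySystem p).φ (S.constArray c' * (w * A N')) := fun N' c' => by
      have h1 := S.tendsto_φ_mul_avgOp_dualFn hp s g f h hb w (fun _ _ => rfl) c' N'
      have h2 := hz ((B N').adjoint (ι c'))
      simp only [ContinuousLinearMap.adjoint_inner_right] at h2
      refine tendsto_nhds_unique h2 (h1.congr fun N => ?_)
      rw [hBι, hι, mul_comm]
    have hdiff : ∀ N' N'', ‖B N' z - B N'' z‖ ≤ E * (S.arraySystem p).nrm (A N' - A N'') :=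
      fun N' N'' => by
      set v := B N' z - B N'' z with hv
      have h1 : ∀ y, inner ℝ v y ≤ ‖y‖ * (E * (S.arraySystem p).nrm (A N' - A N'')) := fun y => by
        refine hd.induction_on (p := fun y =>
          inner ℝ v y ≤ ‖y‖ * (E * (S.arraySystem p).nrm (A N' - A N''))) y
          (isClosed_le (by fun_prop) (by fun_prop)) fun c' => ?_
        rw [hv, inner_sub_left, hBz, hBz, ← map_sub, ← mul_sub, ← mul_sub, hn,
          ← S.nrm_constArray hp c']
        refine (le_abs_self _).trans (((S.arraySystem p).abs_φ_mul_le _ _).trans ?_)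
        exact mul_le_mul_of_nonneg_left (hE.2 _) ((S.arraySystem p).nrm_nonneg _)
      have h2 := h1 v
      rw [real_inner_self_eq_norm_sq, sq] at h2
      rcases (norm_nonneg v).eq_or_lt with h0 | h0
      · rw [← h0]
        exact mul_nonneg hE.1 ((S.arraySystem p).nrm_nonneg _)
      · exact le_of_mul_le_mul_left h2 h0
    intro δ hδ
    have hE1 : 0 < E + 1 := by linarith [hE.1]
    obtain ⟨N₀, h₀⟩ := ih p (S.diffArray g f h) (δ / (E + 1)) (by positivity)
    refine ⟨N₀, fun N hN N' hN' => ?_⟩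
    have h1 := h₀ N hN N' hN'
    rw [lt_div_iff₀ hE1] at h1
    rw [dist_eq_norm]
    refine lt_of_le_of_lt (hdiff N N') (lt_of_le_of_lt ?_ h1)
    rw [mul_comm]
    exact mul_le_mul_of_nonneg_left (by linarith) ((S.arraySystem p).nrm_nonneg _)
  have h0 : inner ℝ z x = 0 := (Submodule.mem_orthogonal K x).1 hx z hzK
  rw [h0] at hzx
  have : 0 < ε ^ 2 := by positivity
  linarith

/-- **Norm convergence of multiple averages** in every state system. -/
theorem cauchyNrm_avg_multTerm (s : Finset ι) (g : ι → G) :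
    ∀ {𝒜 : Type v} [CommRing 𝒜] [Algebra ℝ 𝒜] (S : StateSystem G 𝒜) (f : ι → 𝒜),
      S.CauchyNrm fun N => avg N (S.multTerm s g f) := by
  classical
  induction s using Finset.induction_on with
  | empty =>
    intro 𝒜 _ _ S f ε hε
    refine ⟨1, fun N hN N' hN' => ?_⟩
    have h1 : ∀ N ≥ 1, avg N (S.multTerm ∅ g f) = 1 := fun N hN => by
      have : (N : ℝ) ≠ 0 := by positivity
      simp only [avg, multTerm, Finset.prod_empty, Finset.sum_const, Finset.card_range]
      rw [← Nat.cast_smul_eq_nsmul ℝ, inv_smul_smul₀ this]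
    simp only [h1 N hN, h1 N' hN', sub_self, S.nrm_zero]
    exact hε
  | insert j s hj ih =>
    intro 𝒜 _ _ S f
    have h1 := S.cauchyNrm_avgOp s g f (g j) (fun p F => ih (S.arraySystem p) F) (f j)
    have h2 : ∀ n, S.multTerm (insert j s) g f n = S.multTerm s g f n * S.ρ (g j ^ n) (f j) :=
      fun n => by rw [multTerm, Finset.prod_insert hj, mul_comm, multTerm]
    simp only [avgOp_apply, ← h2] at h1
    exact h1

end StateSystem

/-! ### Limits of measures with prescribed marginals -/

namespace Satedness

open scoped ENNReal

section Boxes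

variable {κ : Type} [Fintype κ] {α : Type u} [MeasurableSpace α]

/-- Two boxes whose sides are close for `μ` have close measures, for every measure with marginals
`μ`. -/
theorem measure_pi_le_add {μ : Measure α} {m : Measure (κ → α)}
    (hm : ∀ i, m.map (fun x => x i) = μ) {A B : κ → Set α}
    (hA : ∀ i, MeasurableSet (A i)) (hB : ∀ i, MeasurableSet (B i)) {δ : ℝ≥0∞}
    (h : ∀ i, μ (A i \ B i) ≤ δ) :
    m (Set.univ.pi A) ≤ m (Set.univ.pi B) + Fintype.card κ * δ := by
  have hsub : Set.univ.pi A ⊆ Set.univ.pi B ∪ ⋃ i, (fun x : κ → α => x i) ⁻¹' (A i \ B i) := by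
    intro x hx
    by_cases hxB : x ∈ Set.univ.pi B
    · exact Or.inl hxB
    · simp only [Set.mem_univ_pi, not_forall] at hxB
      obtain ⟨i, hi⟩ := hxB
      exact Or.inr (Set.mem_iUnion.2 ⟨i, hx i trivial, hi⟩)
  refine (measure_mono hsub).trans ((measure_union_le _ _).trans ?_)
  gcongr
  refine (measure_iUnion_fintype_le _ _).trans ?_
  calc ∑ i, m ((fun x : κ → α => x i) ⁻¹' (A i \ B i)) ≤ ∑ _i : κ, δ := by
        refine Finset.sum_le_sum fun i _ => ?_
        rw [← Measure.map_apply (measurable_pi_apply i) ((hA i).diff (hB i)), hm]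
        exact h i
    _ = Fintype.card κ * δ := by simp

/-- Probability measures on a power of a standard Borel space that all have marginals `μ` and
whose values on boxes converge have a limit probability measure. -/
theorem exists_measure_of_tendsto_pi [StandardBorelSpace α] {μ : Measure α} [IsProbabilityMeasure μ]
    (ν : ℕ → Measure (κ → α)) [∀ N, IsProbabilityMeasure (ν N)]
    (hν : ∀ N i, (ν N).map (fun x => x i) = μ) {L : (κ → Set α) → ℝ≥0∞}
    (hL : ∀ A, (∀ i, MeasurableSet (A i)) →
      Tendsto (fun N => ν N (Set.univ.pi A)) atTop (𝓝 (L A))) :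
    ∃ ν' : Measure (κ → α), IsProbabilityMeasure ν' ∧
      ∀ A, (∀ i, MeasurableSet (A i)) → ν' (Set.univ.pi A) = L A := by
  let _ := upgradeStandardBorel α
  let P : ℕ → ProbabilityMeasure (κ → α) := fun N => ⟨ν N, inferInstance⟩
  have htight : IsTightMeasureSet
      {((m : ProbabilityMeasure (κ → α)) : Measure (κ → α)) | m ∈ Set.range P} := by
    rw [isTightMeasureSet_iff_exists_isCompact_measure_compl_le]
    intro ε hε
    -- for empty `κ` this `δ` is `∞`, which does no harm
    obtain ⟨δ, hδ, hδε⟩ : ∃ δ : ℝ≥0∞, 0 < δ ∧ Fintype.card κ * δ ≤ ε :=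
      ⟨ε / (Fintype.card κ), ENNReal.div_pos hε.ne' (by simp), ENNReal.mul_div_le⟩
    have hμ : IsTightMeasureSet {μ} := isTightMeasureSet_singleton
    rw [isTightMeasureSet_iff_exists_isCompact_measure_compl_le] at hμ
    obtain ⟨K, hK, hKμ⟩ := hμ δ hδ
    refine ⟨Set.univ.pi fun _ => K, isCompact_univ_pi fun _ => hK, ?_⟩
    rintro _ ⟨_, ⟨N, rfl⟩, rfl⟩
    change ν N _ ≤ ε
    have hKm : MeasurableSet K := hK.isClosed.measurableSet
    have h1 : (Set.univ.pi fun _ : κ => K)ᶜ ⊆ ⋃ i, (fun x : κ → α => x i) ⁻¹' Kᶜ := by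
      intro x hx
      simpa using hx
    refine (measure_mono h1).trans ((measure_iUnion_fintype_le _ _).trans ?_)
    refine le_trans ?_ hδε
    calc ∑ i, ν N ((fun x : κ → α => x i) ⁻¹' Kᶜ) ≤ ∑ _i : κ, δ := by
          refine Finset.sum_le_sum fun i _ => ?_
          rw [← Measure.map_apply (measurable_pi_apply i) hKm.compl, hν]
          exact hKμ μ rfl
      _ = Fintype.card κ * δ := by simp
  obtain ⟨p, hp⟩ : ∃ p : Ultrafilter ℕ, (p : Filter ℕ) ≤ atTop :=
    ⟨Ultrafilter.of atTop, Ultrafilter.of_le _⟩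
  obtain ⟨Q, -, hQ⟩ := (isCompact_closure_of_isTightMeasureSet htight).ultrafilter_le_nhds'
    (p.map P)
    (by
      rw [Ultrafilter.mem_map]
      exact Filter.univ_mem' fun N => subset_closure ⟨N, rfl⟩)
  have hlim : Tendsto P p (𝓝 Q) := hQ
  refine ⟨Q, inferInstance, fun A hA => ?_⟩
  have hLp : ∀ B : κ → Set α, (∀ i, MeasurableSet (B i)) →
      Tendsto (fun N => ν N (Set.univ.pi B)) p (𝓝 (L B)) :=
    fun B hB => (hL B hB).mono_left hp
  refine le_antisymm ?_ ?_
  · -- compare with an open box from outside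
    refine ENNReal.le_of_forall_pos_le_add fun ε hε _ => ?_
    obtain ⟨δ, hδ, hδε⟩ : ∃ δ : ℝ≥0∞, 0 < δ ∧ Fintype.card κ * δ ≤ ε :=
      ⟨ε / (Fintype.card κ), ENNReal.div_pos (by exact_mod_cast hε.ne') (by simp),
        ENNReal.mul_div_le⟩
    choose U hAU hU _ hUA using fun i =>
      (hA i).exists_isOpen_sdiff_lt (measure_ne_top μ _) hδ.ne'
    have hUm : ∀ i, MeasurableSet (U i) := fun i => (hU i).measurableSet
    calc (Q : Measure (κ → α)) (Set.univ.pi A) ≤ (Q : Measure (κ → α)) (Set.univ.pi U) :=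
          measure_mono (Set.pi_mono fun i _ => hAU i)
      _ ≤ (p : Filter ℕ).liminf fun N => ν N (Set.univ.pi U) :=
          ProbabilityMeasure.le_liminf_measure_open_of_tendsto hlim
            (isOpen_set_pi Set.finite_univ fun i _ => hU i)
      _ = L U := (hLp U hUm).liminf_eq
      _ ≤ L A + Fintype.card κ * δ := by
          refine le_of_tendsto_of_tendsto' (hLp U hUm) ((hLp A hA).add tendsto_const_nhds)
            fun N => measure_pi_le_add (hν N) hUm hA fun i => (hUA i).le
      _ ≤ L A + ε := by gcongr
  · -- compare with a closed box from inside
    refine ENNReal.le_of_forall_pos_le_add fun ε hε _ => ?_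
    obtain ⟨δ, hδ, hδε⟩ : ∃ δ : ℝ≥0∞, 0 < δ ∧ Fintype.card κ * δ ≤ ε :=
      ⟨ε / (Fintype.card κ), ENNReal.div_pos (by exact_mod_cast hε.ne') (by simp),
        ENNReal.mul_div_le⟩
    choose F hFA hF hAF using fun i =>
      (hA i).exists_isClosed_sdiff_lt (measure_ne_top μ _) hδ.ne'
    have hFm : ∀ i, MeasurableSet (F i) := fun i => (hF i).measurableSet
    calc L A ≤ L F + Fintype.card κ * δ := by
          refine le_of_tendsto_of_tendsto' (hLp A hA) ((hLp F hFm).add tendsto_const_nhds)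
            fun N => measure_pi_le_add (hν N) hA hFm fun i => (hAF i).le
      _ = ((p : Filter ℕ).limsup fun N => ν N (Set.univ.pi F)) +
            Fintype.card κ * δ := by rw [(hLp F hFm).limsup_eq]
      _ ≤ (Q : Measure (κ → α)) (Set.univ.pi F) + Fintype.card κ * δ := by
          gcongr
          exact ProbabilityMeasure.limsup_measure_closed_le_of_tendsto hlim
            (isClosed_set_pi fun i _ => hF i)
      _ ≤ (Q : Measure (κ → α)) (Set.univ.pi A) + ε := by
          exact add_le_add (measure_mono (Set.pi_mono fun i _ => hFA i)) hδε

end Boxes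

end Satedness

/-! ### Existence and uniqueness of the Furstenberg self-joining -/

namespace StateSystem

theorem CauchyNrm.exists_tendsto_φ {G : Type} [CommGroup G] {𝒜 : Type v} [CommRing 𝒜]
    [Algebra ℝ 𝒜] {S : StateSystem G 𝒜} {u : ℕ → 𝒜} (hu : S.CauchyNrm u) :
    ∃ L, Tendsto (fun N => S.φ (u N)) atTop (𝓝 L) := by
  refine cauchySeq_tendsto_of_complete (Metric.cauchySeq_iff.2 fun ε hε => ?_)
  have h1 : 0 < S.nrm 1 + 1 := by linarith [S.nrm_nonneg 1]
  obtain ⟨N₀, h₀⟩ := hu (ε / (S.nrm 1 + 1)) (by positivity)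
  refine ⟨N₀, fun N hN N' hN' => ?_⟩
  have h2 := h₀ N hN N' hN'
  rw [lt_div_iff₀ h1] at h2
  rw [Real.dist_eq, ← map_sub]
  have h3 := S.abs_φ_mul_le (u N - u N') 1
  rw [mul_one] at h3
  nlinarith [S.nrm_nonneg (u N - u N')]

end StateSystem

namespace Satedness

open scoped ENNReal

section BoundedFunctions

/-- The algebra of bounded measurable functions. -/
def bddMeasurable (α : Type u) [MeasurableSpace α] : Subalgebra ℝ (α → ℝ) where
  carrier := {f | Measurable f ∧ ∃ C : ℝ, ∀ x, |f x| ≤ C}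
  mul_mem' := by
    rintro f g ⟨hf, C, hC⟩ ⟨hg, D, hD⟩
    refine ⟨hf.mul hg, C * D, fun x => ?_⟩
    rw [Pi.mul_apply, abs_mul]
    exact mul_le_mul (hC x) (hD x) (abs_nonneg _) ((abs_nonneg _).trans (hC x))
  add_mem' := by
    rintro f g ⟨hf, C, hC⟩ ⟨hg, D, hD⟩
    exact ⟨hf.add hg, C + D, fun x => (abs_add_le _ _).trans (add_le_add (hC x) (hD x))⟩
  algebraMap_mem' c := ⟨measurable_const, |c|, fun _ => le_rfl⟩

theorem integrable_bddMeasurable {α : Type u} [MeasurableSpace α] (μ : Measure α)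
    [IsFiniteMeasure μ] (f : bddMeasurable α) : Integrable f.1 μ := by
  obtain ⟨hf, C, hC⟩ := f.2
  exact Integrable.of_bound hf.aestronglyMeasurable C (Eventually.of_forall hC)

variable {Γ : Type} [AddCommGroup Γ]

/-- The bounded measurable functions on a system, with the integral as state and the action by
composition. -/
noncomputable def functionSystem (X : PPSystem.{u} Γ) :
    StateSystem (Multiplicative Γ) (bddMeasurable X.carrier) where
  φ :=
    { toFun := fun f => ∫ x, f.1 x ∂X.μ
      map_add' := fun f g =>
        integral_add (integrable_bddMeasurable X.μ f) (integrable_bddMeasurable X.μ g)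
      map_smul' := fun c f => integral_smul c f.1 }
  ρ :=
    { toFun := fun γ =>
        { toFun := fun f => ⟨fun x => f.1 (X.T γ.toAdd x),
            f.2.1.comp (X.measurePreserving _).measurable,
            f.2.2.imp fun C hC x => hC _⟩
          map_one' := rfl
          map_mul' := fun f g => rfl
          map_zero' := rfl
          map_add' := fun f g => rfl
          commutes' := fun c => rfl }
      map_one' := by
        ext f x
        simp [X.T_zero]
      map_mul' := fun γ δ => by
        ext f x
        change f.1 (X.T (γ.toAdd + δ.toAdd) x) = f.1 (X.T δ.toAdd (X.T γ.toAdd x))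
        rw [add_comm, X.T_add]
        rfl }
  nonneg f := integral_nonneg fun x => mul_self_nonneg (f.1 x)
  invariant γ f := by
    change ∫ x, f.1 (X.T γ.toAdd x) ∂X.μ = ∫ x, f.1 x ∂X.μ
    have hT := X.measurePreserving γ.toAdd
    rw [← integral_map hT.measurable.aemeasurable f.2.1.aestronglyMeasurable, hT.map_eq]
  bdd f := by
    obtain ⟨-, C, hC⟩ := f.2
    have hC0 : 0 ≤ |C| := abs_nonneg C
    refine ⟨|C|, hC0, fun b => ?_⟩
    change ∫ x, ((f * b) * (f * b)).1 x ∂X.μ ≤ |C| ^ 2 * ∫ x, (b * b).1 x ∂X.μ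
    rw [← integral_const_mul]
    refine integral_mono (integrable_bddMeasurable X.μ _)
      ((integrable_bddMeasurable X.μ (b * b)).const_mul _) fun x => ?_
    change (f.1 x * b.1 x) * (f.1 x * b.1 x) ≤ |C| ^ 2 * (b.1 x * b.1 x)
    have h1 : f.1 x ^ 2 ≤ |C| ^ 2 := by
      rw [← sq_abs]
      exact pow_le_pow_left₀ (abs_nonneg _) ((hC x).trans (le_abs_self C)) 2
    nlinarith [mul_le_mul_of_nonneg_right h1 (mul_self_nonneg (b.1 x))]

end BoundedFunctions

variable {d : ℕ}

theorem sum_Icc_one_eq_sum_range {M : Type*} [AddCommMonoid M] (f : ℕ → M) (N : ℕ) :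
    ∑ n ∈ Finset.Icc 1 N, f n = ∑ n ∈ Finset.range N, f (n + 1) := by
  induction N with
  | zero => simp
  | succ N ih => rw [Finset.sum_Icc_succ_top (by omega), ih, Finset.sum_range_succ]

theorem exists_tendsto_avg_box (X : PPSystem.{u} (Fin d → ℤ)) (A : Fin d → Set X.carrier)
    (hA : ∀ i, MeasurableSet (A i)) :
    ∃ L, Tendsto (fun N : ℕ => (1 / (N : ℝ)) *
        ∑ n ∈ Finset.Icc 1 N, X.μ.real (⋂ i, X.T ((n : ℤ) • stdVec i) ⁻¹' A i))
      atTop (𝓝 L) := by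
  classical
  -- the preimage under `T^{e_i}` accounts for averaging over `[1, N]` instead of `[0, N)`
  let f : Fin d → bddMeasurable X.carrier := fun i =>
    ⟨(X.T (stdVec i) ⁻¹' A i).indicator 1,
      measurable_one.indicator ((X.measurePreserving _).measurable (hA i)), 1, fun x => by
        by_cases hx : x ∈ X.T (stdVec i) ⁻¹' A i <;> simp [hx]⟩
  let g : Fin d → Multiplicative (Fin d → ℤ) := fun i => Multiplicative.ofAdd (stdVec i)
  obtain ⟨L, hL⟩ :=
    (StateSystem.cauchyNrm_avg_multTerm Finset.univ g (functionSystem X) f).exists_tendsto_φ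
  refine ⟨L, hL.congr fun N => ?_⟩
  rw [StateSystem.map_avg, StateSystem.avg, smul_eq_mul, one_div, sum_Icc_one_eq_sum_range]
  congr 1
  refine Finset.sum_congr rfl fun n _ => ?_
  have hB : MeasurableSet (⋂ i, X.T (((n + 1 : ℕ) : ℤ) • stdVec i) ⁻¹' A i) :=
    MeasurableSet.iInter fun i => (X.measurePreserving _).measurable (hA i)
  rw [← integral_indicator_one hB]
  refine integral_congr_ae (Eventually.of_forall fun x => ?_)
  have h1 : ((functionSystem X).multTerm Finset.univ g f n).1 x =
      ∏ i, (f i).1 (X.T ((n : ℤ) • stdVec i) x) := by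
    rw [StateSystem.multTerm, ← Subalgebra.val_apply, map_prod, Finset.prod_apply]
    refine Finset.prod_congr rfl fun i _ => ?_
    rw [natCast_zsmul]
    rfl
  have h2 : ∀ i, X.T (stdVec i) (X.T ((n : ℤ) • stdVec i) x) =
      X.T (((n + 1 : ℕ) : ℤ) • stdVec i) x := fun i => by
    rw [← Function.comp_apply (f := X.T (stdVec i)), ← X.T_add]
    congr 1
    push_cast
    rw [add_smul, one_smul, add_comm]
  change ((functionSystem X).multTerm Finset.univ g f n).1 x = _
  rw [h1]
  simp only [f, Set.indicator_apply, Set.mem_preimage, h2, Pi.one_apply, Finset.prod_boole,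
    Finset.mem_univ, forall_true_left, Set.mem_iInter]

/-- The empirical measure `(1/N) ∑_{n=1}^N` of the images of `μ` under
`x ↦ (T^{n e_1} x, …, T^{n e_d} x)`. -/
noncomputable def empiricalJoining (X : PPSystem.{u} (Fin d → ℤ)) (N : ℕ) :
    Measure (Fin d → X.carrier) :=
  (N : ℝ≥0∞)⁻¹ • ∑ n ∈ Finset.Icc 1 N, X.μ.map fun x i => X.T ((n : ℤ) • stdVec i) x

theorem measurable_orbit (X : PPSystem.{u} (Fin d → ℤ)) (n : ℕ) :
    Measurable fun (x : X.carrier) (i : Fin d) => X.T ((n : ℤ) • stdVec i) x :=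
  measurable_pi_lambda _ fun _ => (X.measurePreserving _).measurable

theorem empiricalJoining_apply (X : PPSystem.{u} (Fin d → ℤ)) (N : ℕ) {B : Set (Fin d → X.carrier)}
    (hB : MeasurableSet B) :
    empiricalJoining X N B = (N : ℝ≥0∞)⁻¹ * ∑ n ∈ Finset.Icc 1 N,
      X.μ ((fun x i => X.T ((n : ℤ) • stdVec i) x) ⁻¹' B) := by
  simp only [empiricalJoining, Measure.smul_apply, Measure.finsetSum_apply, smul_eq_mul]
  congr 1
  exact Finset.sum_congr rfl fun n _ => Measure.map_apply (measurable_orbit X n) hB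

theorem empiricalJoining_pi (X : PPSystem.{u} (Fin d → ℤ)) (N : ℕ) (hN : N ≠ 0)
    {A : Fin d → Set X.carrier} (hA : ∀ i, MeasurableSet (A i)) :
    empiricalJoining X N (Set.univ.pi A) = ENNReal.ofReal ((1 / (N : ℝ)) *
      ∑ n ∈ Finset.Icc 1 N, X.μ.real (⋂ i, X.T ((n : ℤ) • stdVec i) ⁻¹' A i)) := by
  rw [empiricalJoining_apply X N (MeasurableSet.univ_pi hA), ENNReal.ofReal_mul (by positivity),
    one_div, ENNReal.ofReal_inv_of_pos (by positivity), ENNReal.ofReal_natCast,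
    ENNReal.ofReal_sum_of_nonneg fun _ _ => measureReal_nonneg]
  congr 1
  refine Finset.sum_congr rfl fun n _ => ?_
  rw [ofReal_measureReal]
  congr 1
  ext x
  simp

theorem map_empiricalJoining (X : PPSystem.{u} (Fin d → ℤ)) (N : ℕ) (hN : N ≠ 0) (i : Fin d) :
    (empiricalJoining X N).map (fun x => x i) = X.μ := by
  ext B hB
  rw [Measure.map_apply (measurable_pi_apply i) hB,
    empiricalJoining_apply X N (measurable_pi_apply i hB)]
  have h1 : ∀ n : ℕ, X.μ ((fun x i => X.T ((n : ℤ) • stdVec i) x) ⁻¹'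
      ((fun x : Fin d → X.carrier => x i) ⁻¹' B)) = X.μ B := fun n =>
    (X.measurePreserving ((n : ℤ) • stdVec i)).measure_preimage hB.nullMeasurableSet
  simp only [h1, Finset.sum_const, Nat.card_Icc, add_tsub_cancel_right, nsmul_eq_mul]
  rw [← mul_assoc, ENNReal.inv_mul_cancel (by exact_mod_cast hN) (by simp), one_mul]

theorem isProbabilityMeasure_empiricalJoining (X : PPSystem.{u} (Fin d → ℤ)) (N : ℕ) (hN : N ≠ 0) :
    IsProbabilityMeasure (empiricalJoining X N) := by
  constructor
  rw [empiricalJoining_apply X N MeasurableSet.univ]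
  simp only [Set.preimage_univ, measure_univ, Finset.sum_const, Nat.card_Icc,
    add_tsub_cancel_right, nsmul_eq_mul, mul_one]
  exact ENNReal.inv_mul_cancel (by exact_mod_cast hN) (by simp)

theorem exists_isFurstenbergSelfJoining (X : PPSystem.{u} (Fin d → ℤ)) :
    ∃ ν, IsFurstenbergSelfJoining X ν := by
  classical
  have hex : ∀ A : Fin d → Set X.carrier, ∃ L : ℝ, (∀ i, MeasurableSet (A i)) →
      Tendsto (fun N : ℕ => (1 / (N : ℝ)) *
        ∑ n ∈ Finset.Icc 1 N, X.μ.real (⋂ i, X.T ((n : ℤ) • stdVec i) ⁻¹' A i)) atTop (𝓝 L) :=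
    fun A => by
      by_cases hA : ∀ i, MeasurableSet (A i)
      · exact (exists_tendsto_avg_box X A hA).imp fun L hL _ => hL
      · exact ⟨0, fun h => absurd h hA⟩
  choose L hL using hex
  have hprob := fun N : ℕ => isProbabilityMeasure_empiricalJoining X (N + 1) N.succ_ne_zero
  obtain ⟨ν, hν, hbox⟩ := exists_measure_of_tendsto_pi (μ := X.μ)
    (fun N => empiricalJoining X (N + 1))
    (fun N i => map_empiricalJoining X (N + 1) N.succ_ne_zero i)
    (L := fun A => ENNReal.ofReal (L A)) fun A hA => by
      simp only [empiricalJoining_pi X _ (Nat.succ_ne_zero _) hA]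
      exact (ENNReal.continuous_ofReal.tendsto _).comp
        ((tendsto_add_atTop_iff_nat 1).2 (hL A hA))
  refine ⟨ν, hν, fun A hA => ?_⟩
  have h0 : 0 ≤ L A := ge_of_tendsto' (hL A hA) fun N => by positivity
  rw [measureReal_def, hbox A hA, ENNReal.toReal_ofReal h0]
  exact hL A hA

theorem IsFurstenbergSelfJoining.unique {X : PPSystem.{u} (Fin d → ℤ)}
    {ν ν' : Measure (Fin d → X.carrier)} (h : IsFurstenbergSelfJoining X ν)
    (h' : IsFurstenbergSelfJoining X ν') : ν = ν' := by
  have := h.isProbabilityMeasure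
  have := h'.isProbabilityMeasure
  refine ext_of_generate_finite _ generateFrom_pi.symm isPiSystem_pi ?_ (by simp)
  rintro _ ⟨A, hA, rfl⟩
  have hA' : ∀ i, MeasurableSet (A i) := fun i => hA i trivial
  exact (measureReal_eq_measureReal_iff).1
    (tendsto_nhds_unique (h.tendsto_box A hA') (h'.tendsto_box A hA'))

end Satedness

/-! ### Maximal factors for joins of classes of partially trivial actions -/

namespace Satedness

section ModNull

variable {α : Type u} {m₀ : MeasurableSpace α} {μ : Measure α}

theorem leModNull_iff {m₁ m₂ : MeasurableSpace α} :
    LEModNull μ m₁ m₂ ↔ m₁ ≤ eventuallyMeasurableSpace m₂ (ae μ) := Iff.rfl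

theorem LEModNull.iSup {ι : Type*} {m : ι → MeasurableSpace α} {m' : MeasurableSpace α}
    (h : ∀ j, LEModNull μ (m j) m') : LEModNull μ (⨆ j, m j) m' :=
  leModNull_iff.2 (iSup_le fun j => leModNull_iff.1 (h j))

theorem LEModNull.mono_right {m₁ m₂ m₃ : MeasurableSpace α} (h : LEModNull μ m₁ m₂)
    (h' : m₂ ≤ m₃) : LEModNull μ m₁ m₃ := fun A hA =>
  (h A hA).imp fun _ hB => ⟨h' _ hB.1, hB.2⟩

/-- Every sub-σ-algebra of a separable measure space is countably generated modulo null sets: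
the indicators of its sets form a separable subset of `L¹`. -/
theorem exists_seq_leModNull_generateFrom {β : Type u} {m m₀ : MeasurableSpace β}
    [MeasurableSpace.CountablyGenerated β] {μ : Measure β} [IsProbabilityMeasure μ] (hm : m ≤ m₀) :
    ∃ A : ℕ → Set β, (∀ n, MeasurableSet[m] (A n)) ∧
      LEModNull μ m (MeasurableSpace.generateFrom (Set.range A)) := by
  let e : {A : Set β // MeasurableSet[m] A} → Lp ℝ 1 μ := fun A =>
    indicatorConstLp 1 (hm _ A.2) (measure_ne_top μ _) (1 : ℝ)
  have : Fact ((1 : ENNReal) ≠ ⊤) := ⟨by simp⟩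
  have : Nonempty (Set.range e) := ⟨⟨_, ⟨∅, @MeasurableSet.empty _ m⟩, rfl⟩⟩
  choose A hA using fun n => (TopologicalSpace.denseSeq (Set.range e) n).2
  refine ⟨fun n => (A n).1, fun n => (A n).2, fun B hB => ?_⟩
  set g := MeasurableSpace.generateFrom (Set.range fun n => (A n).1) with hg
  have hgm : g ≤ m₀ := by
    refine MeasurableSpace.generateFrom_le ?_
    rintro _ ⟨n, rfl⟩
    exact hm _ (A n).2
  have hclosed := isClosed_aestronglyMeasurable (F := ℝ) (p := 1) (μ := μ) hgm
  have hB' : AEStronglyMeasurable[g] (e ⟨B, hB⟩) μ := by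
    have h1 : (⟨e ⟨B, hB⟩, ⟨B, hB⟩, rfl⟩ : Set.range e) ∈
        closure (Set.range (TopologicalSpace.denseSeq (Set.range e))) :=
      TopologicalSpace.denseRange_denseSeq _ _
    have h2 : IsClosed {f : Set.range e | AEStronglyMeasurable[g] (f : Lp ℝ 1 μ) μ} :=
      hclosed.preimage continuous_subtype_val
    refine closure_minimal ?_ h2 h1
    rintro _ ⟨n, rfl⟩
    change AEStronglyMeasurable[g] (TopologicalSpace.denseSeq (Set.range e) n : Lp ℝ 1 μ) μ
    rw [← hA n]
    refine ⟨(A n).1.indicator fun _ => (1 : ℝ), ?_, indicatorConstLp_coeFn⟩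
    exact stronglyMeasurable_const.indicator
      (MeasurableSpace.measurableSet_generateFrom ⟨n, rfl⟩)
  obtain ⟨f, hf, hfe⟩ := hB'
  refine ⟨f ⁻¹' {1}, hf.measurable (measurableSet_singleton 1), ?_⟩
  filter_upwards [hfe, indicatorConstLp_coeFn (p := 1) (hs := hm _ hB)
    (hμs := measure_ne_top μ B) (c := (1 : ℝ))] with x h1 h2
  have h3 : f x = B.indicator (fun _ => (1 : ℝ)) x := h1.symm.trans h2
  refine propext (?_ : x ∈ B ↔ f x = 1)
  rw [h3]
  by_cases hx : x ∈ B <;> simp [hx]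

end ModNull

variable {Γ : Type} [AddCommGroup Γ]

section Coding

variable (X : PPSystem.{u} Γ) {κ : Type} (A : κ → Set X.carrier)

open Classical in
/-- The itinerary of a point with respect to the sets `A k`, recorded along its whole orbit. -/
noncomputable def itinerary (x : X.carrier) (γ : Γ) (k : κ) : ULift.{u} Bool :=
  ULift.up (decide (X.T γ x ∈ A k))

variable {A}

theorem measurable_itinerary (hA : ∀ k, MeasurableSet (A k)) : Measurable (itinerary X A) := by
  classical
  refine measurable_pi_lambda _ fun γ => measurable_pi_lambda _ fun k => ?_
  refine measurable_up.comp (measurable_to_bool ?_)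
  have : (fun x => decide (X.T γ x ∈ A k)) ⁻¹' {true} = X.T γ ⁻¹' A k := by
    ext x
    simp
  rw [this]
  exact (X.measurePreserving γ).measurable (hA k)

theorem itinerary_T (δ : Γ) (x : X.carrier) :
    itinerary X A (X.T δ x) = fun γ => itinerary X A x (γ + δ) := by
  funext γ k
  simp [itinerary, X.T_add]

variable [Countable Γ] [Countable κ]

/-- The symbolic factor given by the itineraries, on which `Γ` acts by shifting. -/
noncomputable def symbolicFactor (hA : ∀ k, MeasurableSet (A k)) : PPSystem.{u} Γ where
  carrier := Γ → κ → ULift.{u} Bool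
  μ := X.μ.map (itinerary X A)
  isProbabilityMeasure :=
    Measure.isProbabilityMeasure_map (measurable_itinerary X hA).aemeasurable
  T δ y := fun γ => y (γ + δ)
  T_zero := by
    funext y γ
    simp
  T_add δ δ' := by
    funext y γ
    simp [add_assoc]
  measurePreserving δ := by
    have hm := measurable_itinerary X hA
    have hT : Measurable fun (y : Γ → κ → ULift.{u} Bool) (γ : Γ) => y (γ + δ) :=
      measurable_pi_lambda _ fun γ => measurable_pi_apply _
    refine ⟨hT, ?_⟩
    rw [Measure.map_map hT hm]
    conv_rhs => rw [← (X.measurePreserving δ).map_eq]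
    rw [Measure.map_map hm (X.measurePreserving δ).measurable]
    congr 1
    funext x
    exact (itinerary_T X δ x).symm

theorem isFactorMap_itinerary (hA : ∀ k, MeasurableSet (A k)) :
    IsFactorMap X (symbolicFactor X hA) (itinerary X A) where
  measurePreserving := ⟨measurable_itinerary X hA, rfl⟩
  equivariant δ := by
    funext x
    exact (itinerary_T X δ x).symm

theorem symbolicFactor_mem_ZZero (hA : ∀ k, MeasurableSet (A k)) {Λ : AddSubgroup Γ}
    (h : ∀ k, MeasurableSet[invariantFactor X Λ] (A k)) : symbolicFactor X hA ∈ ZZero Λ := by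
  intro δ hδ
  have hS : MeasurableSet {y : Γ → κ → ULift.{u} Bool | (fun γ => y (γ + δ)) = y} :=
    measurableSet_eq_fun (measurable_pi_lambda _ fun γ => measurable_pi_apply _) measurable_id
  refine (ae_map_iff (measurable_itinerary X hA).aemeasurable hS).2 ?_
  have h1 : ∀ γ k, ∀ᵐ x ∂X.μ, (X.T δ (X.T γ x) ∈ A k ↔ X.T γ x ∈ A k) := fun γ k => by
    have h2 := (X.measurePreserving γ).quasiMeasurePreserving.ae ((h k).2 δ hδ).mem_iff
    exact h2
  filter_upwards [ae_all_iff.2 fun γ => ae_all_iff.2 (h1 γ)] with x hx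
  change (fun γ => itinerary X A x (γ + δ)) = itinerary X A x
  funext γ k
  have h3 : X.T (γ + δ) x = X.T δ (X.T γ x) := by
    rw [add_comm, X.T_add]
    rfl
  refine congrArg ULift.up (decide_eq_decide.2 ?_)
  rw [h3]
  exact hx γ k

theorem measurableSet_factorAlgebra_symbolicFactor (hA : ∀ k, MeasurableSet (A k)) (k : κ) :
    MeasurableSet[factorAlgebra X (symbolicFactor X hA) (itinerary X A)] (A k) := by
  have hS : MeasurableSet {y : Γ → κ → ULift.{u} Bool | y 0 k = ULift.up true} :=
    ((measurable_pi_apply k).comp (measurable_pi_apply 0)) (measurableSet_singleton _)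
  refine ⟨_, hS, ?_⟩
  ext x
  classical
  change ULift.up (decide (X.T 0 x ∈ A k)) = ULift.up true ↔ x ∈ A k
  rw [X.T_zero]
  simp

end Coding

theorem factorAlgebra_le_invariantFactor {X Y : PPSystem.{u} Γ} {ζ : X.carrier → Y.carrier}
    (hζ : IsFactorMap X Y ζ) {Λ : AddSubgroup Γ} (hY : Y ∈ ZZero Λ) :
    factorAlgebra X Y ζ ≤ invariantFactor X Λ := by
  rintro _ ⟨B, hB, rfl⟩
  refine ⟨hζ.measurePreserving.measurable hB, fun γ hγ => ?_⟩
  have h1 : ∀ᵐ x ∂X.μ, Y.T γ (ζ x) = ζ x :=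
    hζ.measurePreserving.quasiMeasurePreserving.ae (hY γ hγ)
  filter_upwards [h1] with x hx
  have h2 : ζ (X.T γ x) = ζ x := (congrFun (hζ.equivariant γ) x).symm.trans hx
  exact congrArg (fun y => y ∈ B) h2

/-- The partially invariant factor is, modulo null sets, generated by a factor map to a system
with trivial subaction, which can be chosen to capture countably many prescribed invariant sets
exactly. -/
theorem exists_factor_mem_ZZero [Countable Γ] (X : PPSystem.{u} Γ) (Λ : AddSubgroup Γ)
    (b : ℕ → Set X.carrier) (hb : ∀ n, MeasurableSet[invariantFactor X Λ] (b n)) :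
    ∃ (Y : PPSystem.{u} Γ) (ζ : X.carrier → Y.carrier), Y ∈ ZZero Λ ∧ IsFactorMap X Y ζ ∧
      LEModNull X.μ (invariantFactor X Λ) (factorAlgebra X Y ζ) ∧
      ∀ n, MeasurableSet[factorAlgebra X Y ζ] (b n) := by
  obtain ⟨A, hA, hgen⟩ := exists_seq_leModNull_generateFrom (μ := X.μ)
    (m := invariantFactor X Λ) (fun _ h => h.1)
  have hinv : ∀ k : ℕ ⊕ ℕ, MeasurableSet[invariantFactor X Λ] (Sum.elim b A k) := by
    rintro (n | n)
    exacts [hb n, hA n]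
  have hmeas : ∀ k, MeasurableSet (Sum.elim b A k) := fun k => (hinv k).1
  refine ⟨symbolicFactor X hmeas, itinerary X (Sum.elim b A), symbolicFactor_mem_ZZero X hmeas hinv,
    isFactorMap_itinerary X hmeas, hgen.mono_right ?_, fun n =>
      measurableSet_factorAlgebra_symbolicFactor X hmeas (Sum.inl n)⟩
  refine MeasurableSpace.generateFrom_le ?_
  rintro _ ⟨n, rfl⟩
  exact measurableSet_factorAlgebra_symbolicFactor X hmeas (Sum.inr n)

section Join

variable {ι : Type} [Countable ι] {X : PPSystem.{u} Γ} {Y : ι → PPSystem.{u} Γ}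
  {ζ : ∀ j, X.carrier → (Y j).carrier}

/-- The joining of a family of factors of `X`: the image of `X` in the product. -/
noncomputable def factorJoin (hζ : ∀ j, IsFactorMap X (Y j) (ζ j)) : PPSystem.{u} Γ where
  carrier := ∀ j, (Y j).carrier
  μ := X.μ.map fun x j => ζ j x
  isProbabilityMeasure := Measure.isProbabilityMeasure_map
    (measurable_pi_lambda _ fun j => (hζ j).measurePreserving.measurable).aemeasurable
  T γ y := fun j => (Y j).T γ (y j)
  T_zero := by
    funext y j
    simp [(Y j).T_zero]
  T_add γ δ := by
    funext y j
    simp [(Y j).T_add]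
  measurePreserving γ := by
    have hm : Measurable fun (x : X.carrier) (j : ι) => ζ j x :=
      measurable_pi_lambda _ fun j => (hζ j).measurePreserving.measurable
    have hT : Measurable fun (y : ∀ j, (Y j).carrier) (j : ι) => (Y j).T γ (y j) :=
      measurable_pi_lambda _ fun j =>
        ((Y j).measurePreserving γ).measurable.comp (measurable_pi_apply j)
    refine ⟨hT, ?_⟩
    rw [Measure.map_map hT hm]
    conv_rhs => rw [← (X.measurePreserving γ).map_eq]
    rw [Measure.map_map hm (X.measurePreserving γ).measurable]
    congr 1
    funext x j
    exact congrFun ((hζ j).equivariant γ) x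

theorem isFactorMap_factorJoin (hζ : ∀ j, IsFactorMap X (Y j) (ζ j)) :
    IsFactorMap X (factorJoin hζ) (fun x j => ζ j x) where
  measurePreserving :=
    ⟨measurable_pi_lambda _ fun j => (hζ j).measurePreserving.measurable, rfl⟩
  equivariant γ := by
    funext x j
    exact congrFun ((hζ j).equivariant γ) x

theorem isFactorMap_factorJoin_eval (hζ : ∀ j, IsFactorMap X (Y j) (ζ j)) (j : ι) :
    IsFactorMap (factorJoin hζ) (Y j) (fun y => y j) where
  measurePreserving := by
    refine ⟨measurable_pi_apply j, ?_⟩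
    change (X.μ.map fun x j => ζ j x).map (fun y => y j) = _
    rw [Measure.map_map (measurable_pi_apply j)
      (isFactorMap_factorJoin hζ).measurePreserving.measurable]
    exact (hζ j).measurePreserving.map_eq
  equivariant γ := rfl

theorem factorJoin_mem_joinClass (hζ : ∀ j, IsFactorMap X (Y j) (ζ j))
    {C : ι → Set (PPSystem.{u} Γ)} (hY : ∀ j, Y j ∈ C j) : factorJoin hζ ∈ joinClass C :=
  ⟨Y, fun j y => y j, hY, isFactorMap_factorJoin_eval hζ, fun A hA => ⟨A, hA, EventuallyEq.rfl⟩⟩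

theorem factorAlgebra_factorJoin (hζ : ∀ j, IsFactorMap X (Y j) (ζ j)) :
    factorAlgebra X (factorJoin hζ) (fun x j => ζ j x) = ⨆ j, factorAlgebra X (Y j) (ζ j) := by
  change MeasurableSpace.comap (fun (x : X.carrier) (j : ι) => ζ j x) MeasurableSpace.pi = _
  rw [MeasurableSpace.pi, MeasurableSpace.comap_iSup]
  simp only [MeasurableSpace.comap_comp]
  rfl

end Join

/-- The maximal factor for a join of classes of partially trivial actions is the join of the
partially invariant factors, modulo null sets. A version of it lies in that join, and captures
countably many prescribed partially invariant sets exactly. -/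
theorem exists_isMaximalClassFactor_join [Countable Γ] {ι : Type} [Countable ι]
    (X : PPSystem.{u} Γ) (Λ : ι → AddSubgroup Γ) (b : ι → ℕ → Set X.carrier)
    (hb : ∀ j n, MeasurableSet[invariantFactor X (Λ j)] (b j n)) :
    ∃ Ξ, IsMaximalClassFactor (joinClass fun j => ZZero (Λ j)) X Ξ ∧
      Ξ ≤ ⨆ j, invariantFactor X (Λ j) ∧ ∀ j n, MeasurableSet[Ξ] (b j n) := by
  choose Y ζ hY hζ hmax hbm using fun j => exists_factor_mem_ZZero X (Λ j) (b j) (hb j)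
  have hle : ∀ j, factorAlgebra X (Y j) (ζ j) ≤ ⨆ j, factorAlgebra X (Y j) (ζ j) := fun j =>
    le_iSup (fun j => factorAlgebra X (Y j) (ζ j)) j
  refine ⟨⨆ j, factorAlgebra X (Y j) (ζ j), ⟨⟨factorJoin hζ, fun x j => ζ j x,
    factorJoin_mem_joinClass hζ hY, isFactorMap_factorJoin hζ,
    (factorAlgebra_factorJoin hζ).symm⟩, ?_⟩, ?_, fun j n => hle j _ (hbm j n)⟩
  · rintro _ ⟨Y', ζ', ⟨Z, π, hZ, hπ, hgen⟩, hζ', rfl⟩ _ ⟨B, hB, rfl⟩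
    obtain ⟨B', hB', hBB'⟩ := hgen B hB
    have h1 : LEModNull X.μ (⨆ j, invariantFactor X (Λ j)) (⨆ j, factorAlgebra X (Y j) (ζ j)) :=
      LEModNull.iSup fun j => (hmax j).mono_right (hle j)
    have h2 : MeasurableSpace.comap ζ' (⨆ j, factorAlgebra Y' (Z j) (π j)) ≤
        ⨆ j, invariantFactor X (Λ j) := by
      rw [MeasurableSpace.comap_iSup]
      refine iSup_mono fun j => ?_
      rw [MeasurableSpace.comap_comp]
      have hcomp : IsFactorMap X (Z j) (π j ∘ ζ') :=
        ⟨(hπ j).measurePreserving.comp hζ'.measurePreserving, fun γ => by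
          rw [← Function.comp_assoc, (hπ j).equivariant, Function.comp_assoc, hζ'.equivariant,
            Function.comp_assoc]⟩
      exact factorAlgebra_le_invariantFactor hcomp (hZ j)
    obtain ⟨D, hD, hBD⟩ := h1 _ (h2 _ ⟨B', hB', rfl⟩)
    refine ⟨D, hD, EventuallyEq.trans ?_ hBD⟩
    exact hζ'.measurePreserving.quasiMeasurePreserving.preimage_ae_eq hBB'
  · exact iSup_mono fun j => factorAlgebra_le_invariantFactor (hζ j) (hY j)

end Satedness

/-! ### The Furstenberg self-joining as an extension -/

namespace Satedness

section Cesaro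

theorem abs_inv_mul_sum_Icc_shift_one_le {a : ℤ → ℝ} {C : ℝ} (ha : ∀ n, |a n| ≤ C) (N : ℕ) :
    |(1 / (N : ℝ)) * ∑ n ∈ Finset.Icc 1 N, (a ((n : ℤ) + 1) - a n)| ≤ (1 / (N : ℝ)) * (2 * C) := by
  have h1 : ∑ n ∈ Finset.Icc 1 N, (a ((n : ℤ) + 1) - a n) = a ((N : ℤ) + 1) - a 1 := by
    rw [sum_Icc_one_eq_sum_range]
    have := Finset.sum_range_sub (fun n : ℕ => a ((n : ℤ) + 1)) N
    push_cast at this ⊢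
    simpa using this
  rw [h1, abs_mul, abs_of_nonneg (by positivity : (0 : ℝ) ≤ 1 / (N : ℝ))]
  refine mul_le_mul_of_nonneg_left ?_ (by positivity)
  refine (abs_sub _ _).trans ?_
  linarith [ha ((N : ℤ) + 1), ha 1]

theorem tendsto_avg_shift_one_sub {a : ℤ → ℝ} {C : ℝ} (ha : ∀ n, |a n| ≤ C) :
    Tendsto (fun N : ℕ => (1 / (N : ℝ)) * ∑ n ∈ Finset.Icc 1 N, (a ((n : ℤ) + 1) - a n))
      atTop (𝓝 0) := by
  refine squeeze_zero_norm (fun N => abs_inv_mul_sum_Icc_shift_one_le ha N) ?_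
  simpa using (tendsto_one_div_atTop_nhds_zero_nat (𝕜 := ℝ)).mul_const (2 * C)

/-- Cesàro averages of bounded sequences are asymptotically shift invariant. -/
theorem tendsto_avg_shift_sub (c : ℤ) : ∀ {a : ℤ → ℝ} {C : ℝ}, (∀ n, |a n| ≤ C) →
    Tendsto (fun N : ℕ => (1 / (N : ℝ)) * ∑ n ∈ Finset.Icc 1 N, (a ((n : ℤ) + c) - a n))
      atTop (𝓝 0) := by
  induction c using Int.induction_on with
  | zero => intro a C _; simp
  | succ c ih =>
    intro a C ha
    have h := (ih (a := fun n => a (n + 1)) (fun n => ha _)).add (tendsto_avg_shift_one_sub ha)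
    rw [add_zero] at h
    refine h.congr fun N => ?_
    rw [← mul_add, ← Finset.sum_add_distrib]
    congr 1
    exact Finset.sum_congr rfl fun n _ => by rw [sub_add_sub_cancel, add_assoc]
  | pred c ih =>
    intro a C ha
    have h := (ih (a := fun n => a (n - 1)) (fun n => ha _)).sub
      (tendsto_avg_shift_one_sub (a := fun n => a (n - 1)) fun n => ha _)
    rw [sub_zero] at h
    refine h.congr fun N => ?_
    rw [← mul_sub, ← Finset.sum_sub_distrib]
    congr 1
    refine Finset.sum_congr rfl fun n _ => ?_
    rw [add_sub_cancel_right, ← add_sub_assoc]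
    ring

end Cesaro

variable {d : ℕ} {X : PPSystem.{u} (Fin d → ℤ)} {ν : Measure (Fin d → X.carrier)}

theorem IsFurstenbergSelfJoining.map_eval (hν : IsFurstenbergSelfJoining X ν) (i : Fin d) :
    ν.map (fun x => x i) = X.μ := by
  classical
  have := hν.isProbabilityMeasure
  ext B hB
  rw [Measure.map_apply (measurable_pi_apply i) hB]
  have hA : ∀ k, MeasurableSet (Function.update (fun _ => Set.univ) i B k) := fun k => by
    rcases eq_or_ne k i with rfl | hk
    · simpa using hB
    · simp [Function.update_of_ne hk]
  have hpre : (fun x : Fin d → X.carrier => x i) ⁻¹' B =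
      Set.univ.pi (Function.update (fun _ => Set.univ) i B) := by
    ext x
    simp only [Set.mem_preimage, Set.mem_univ_pi]
    refine ⟨fun h k => ?_, fun h => by simpa using h i⟩
    rcases eq_or_ne k i with rfl | hk
    · simpa using h
    · simp [Function.update_of_ne hk]
  have hconst : ∀ n : ℕ, X.μ.real (⋂ k, X.T ((n : ℤ) • stdVec k) ⁻¹'
      Function.update (fun _ => Set.univ) i B k) = X.μ.real B := fun n => by
    have h1 : (⋂ k, X.T ((n : ℤ) • stdVec k) ⁻¹' Function.update (fun _ => Set.univ) i B k) =
        X.T ((n : ℤ) • stdVec i) ⁻¹' B := by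
      ext x
      simp only [Set.mem_iInter, Set.mem_preimage]
      refine ⟨fun h => by simpa using h i, fun h k => ?_⟩
      rcases eq_or_ne k i with rfl | hk
      · simpa using h
      · simp [Function.update_of_ne hk]
    rw [h1]
    exact (X.measurePreserving _).measureReal_preimage hB.nullMeasurableSet
  have hlim := hν.tendsto_box _ hA
  simp only [hconst, Finset.sum_const, Nat.card_Icc, add_tsub_cancel_right, nsmul_eq_mul] at hlim
  have hlim' : Tendsto (fun N : ℕ => 1 / (N : ℝ) * ((N : ℝ) * X.μ.real B)) atTop
      (𝓝 (X.μ.real B)) := by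
    refine tendsto_const_nhds.congr' ?_
    filter_upwards [eventually_ne_atTop 0] with N hN
    have : (N : ℝ) ≠ 0 := by exact_mod_cast hN
    field_simp
  rw [hpre]
  exact (measureReal_eq_measureReal_iff).1 (tendsto_nhds_unique hlim hlim')

/-- The `k`-th component `γ - γ_i e_i + γ_i e_k` of the homomorphism `ℤ^d → (ℤ^d)^d` sending `e_i`
to `(e_1, …, e_d)` and `e_j`, for `j ≠ i`, to `(e_j, …, e_j)`. -/
def liftVec (i : Fin d) (γ : Fin d → ℤ) (k : Fin d) : Fin d → ℤ :=
  γ - γ i • stdVec i + γ i • stdVec k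

theorem liftVec_zero (i k : Fin d) : liftVec i 0 k = 0 := by simp [liftVec]

theorem liftVec_add (i : Fin d) (γ δ : Fin d → ℤ) (k : Fin d) :
    liftVec i (γ + δ) k = liftVec i γ k + liftVec i δ k := by
  simp only [liftVec, Pi.add_apply, add_smul]
  abel

theorem liftVec_self (i : Fin d) (γ : Fin d → ℤ) : liftVec i γ i = γ := by simp [liftVec]

theorem liftVec_of_mem_diffSubgroup {i j : Fin d} (hij : j ≠ i) {γ : Fin d → ℤ}
    (hγ : γ ∈ diffSubgroup i j) : liftVec i γ j = 0 := by
  obtain ⟨m, rfl⟩ := AddSubgroup.mem_zmultiples_iff.1 hγ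
  have h1 : (m • (stdVec i - stdVec j : Fin d → ℤ)) i = m := by
    simp [stdVec, Pi.single_eq_of_ne hij.symm]
  rw [liftVec, h1, smul_sub]
  abel

/-- On boxes, acting by `liftVec i γ` shifts the averaging variable by `γ_i`, up to one common
measure-preserving transformation, and this does not change the limit. -/
theorem IsFurstenbergSelfJoining.measurePreserving_lift (hν : IsFurstenbergSelfJoining X ν)
    (i : Fin d) (γ : Fin d → ℤ) :
    MeasurePreserving (fun (x : Fin d → X.carrier) k => X.T (liftVec i γ k) (x k)) ν ν := by
  have := hν.isProbabilityMeasure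
  have hm : Measurable fun (x : Fin d → X.carrier) k => X.T (liftVec i γ k) (x k) :=
    measurable_pi_lambda _ fun k => (X.measurePreserving _).measurable.comp (measurable_pi_apply k)
  refine ⟨hm, ?_⟩
  have hprob : IsProbabilityMeasure (ν.map fun x k => X.T (liftVec i γ k) (x k)) :=
    Measure.isProbabilityMeasure_map hm.aemeasurable
  -- the image of `ν` has the defining property of the self-joining
  refine IsFurstenbergSelfJoining.unique (X := X) ⟨hprob, fun A hA => ?_⟩ hν
  have hbox := hν.tendsto_box A hA
  have hA' : ∀ k, MeasurableSet (X.T (liftVec i γ k) ⁻¹' A k) := fun k =>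
    (X.measurePreserving _).measurable (hA k)
  have hbox' := hν.tendsto_box _ hA'
  have hpre : (ν.map fun x k => X.T (liftVec i γ k) (x k)).real (Set.univ.pi A) =
      ν.real (Set.univ.pi fun k => X.T (liftVec i γ k) ⁻¹' A k) := by
    rw [map_measureReal_apply hm (MeasurableSet.univ_pi hA)]
    congr 1
  rw [hpre]
  let a : ℤ → ℝ := fun n => X.μ.real (⋂ k, X.T (n • stdVec k) ⁻¹' A k)
  have ha : ∀ n, |a n| ≤ 1 := fun n => by
    rw [abs_of_nonneg measureReal_nonneg]
    exact measureReal_le_one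
  have hshift : ∀ n : ℕ, X.μ.real (⋂ k, X.T ((n : ℤ) • stdVec k) ⁻¹'
      (X.T (liftVec i γ k) ⁻¹' A k)) = a ((n : ℤ) + γ i) := fun n => by
    have h1 : (⋂ k, X.T ((n : ℤ) • stdVec k) ⁻¹' (X.T (liftVec i γ k) ⁻¹' A k)) =
        X.T (γ - γ i • stdVec i) ⁻¹' ⋂ k, X.T (((n : ℤ) + γ i) • stdVec k) ⁻¹' A k := by
      rw [Set.preimage_iInter]
      refine Set.iInter_congr fun k => ?_
      rw [← Set.preimage_comp, ← Set.preimage_comp, ← X.T_add, ← X.T_add]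
      congr 2
      rw [liftVec, add_smul]
      abel
    rw [h1]
    exact (X.measurePreserving _).measureReal_preimage (MeasurableSet.iInter fun k =>
      (X.measurePreserving _).measurable (hA k)).nullMeasurableSet
  simp only [hshift] at hbox'
  have hlim := hbox'.sub (tendsto_avg_shift_sub (γ i) ha)
  rw [sub_zero] at hlim
  refine hlim.congr fun N => ?_
  rw [← mul_sub, ← Finset.sum_sub_distrib]
  simp only [sub_sub_cancel]
  rfl

/-- The Furstenberg self-joining as a system extending `X` through the `i`-th coordinate: `e_i`
acts by `T^{e_1} × ⋯ × T^{e_d}`, the other basis vectors act diagonally. -/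
noncomputable def liftSystem (hν : IsFurstenbergSelfJoining X ν) (i : Fin d) :
    PPSystem.{u} (Fin d → ℤ) where
  carrier := Fin d → X.carrier
  μ := ν
  isProbabilityMeasure := hν.isProbabilityMeasure
  T γ x := fun k => X.T (liftVec i γ k) (x k)
  T_zero := by
    funext x k
    simp [liftVec_zero, X.T_zero]
  T_add γ δ := by
    funext x k
    simp [liftVec_add, X.T_add]
  measurePreserving γ := hν.measurePreserving_lift i γ

theorem isFactorMap_liftSystem (hν : IsFurstenbergSelfJoining X ν) (i : Fin d) :
    IsFactorMap (liftSystem hν i) X (fun x : Fin d → X.carrier => x i) where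
  measurePreserving := ⟨measurable_pi_apply i, hν.map_eval i⟩
  equivariant γ := by
    funext x
    change X.T γ (x i) = X.T (liftVec i γ i) (x i)
    rw [liftVec_self]

theorem measurableSet_invariantFactor_liftSystem (hν : IsFurstenbergSelfJoining X ν) {i j : Fin d}
    (hij : j ≠ i) {B : Set X.carrier} (hB : MeasurableSet B) :
    MeasurableSet[invariantFactor (liftSystem hν i) (diffSubgroup i j)]
      ((fun x : Fin d → X.carrier => x j) ⁻¹' B) := by
  refine ⟨measurable_pi_apply j hB, fun γ hγ => ?_⟩
  refine EventuallyEq.of_eq ?_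
  ext x
  change X.T (liftVec i γ j) (x j) ∈ B ↔ x j ∈ B
  rw [liftVec_of_mem_diffSubgroup hij hγ, X.T_zero]
  rfl

/-! ### Relative independence -/

theorem coordAlgebra_le (X : PPSystem.{u} (Fin d → ℤ)) (i : Fin d) :
    coordAlgebra X i X.measurableSpace ≤ MeasurableSpace.pi :=
  (measurable_pi_apply i).comap_le

theorem pairJoin_le (X : PPSystem.{u} (Fin d → ℤ)) (i : Fin d) :
    pairJoin X i ≤ X.measurableSpace :=
  iSup_le fun _ _ h => h.1

/-- Satedness makes the join of the two-fold invariant factors characteristic for the `i`-th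
coordinate: the other coordinates are measurable with respect to the maximal factor of the
extension `liftSystem`. -/
theorem integral_mul_prod_eq_zero (hν : IsFurstenbergSelfJoining X ν) (i : Fin d)
    (hX : IsSated (classC.{u} i) X) {D : (Fin d → X.carrier) → ℝ}
    (hD : StronglyMeasurable[coordAlgebra X i X.measurableSpace] D) (hDb : MemLp D ⊤ ν)
    (hD0 : ν[D | coordAlgebra X i (pairJoin X i)] =ᵐ[ν] 0)
    {F : Fin d → (Fin d → X.carrier) → ℝ}
    (hF : ∀ j, StronglyMeasurable[coordAlgebra X j X.measurableSpace] (F j))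
    (hFb : ∀ j, MemLp (F j) ⊤ ν) :
    ∫ x, D x * ∏ j ∈ Finset.univ.erase i, F j x ∂ν = 0 := by
  have := hν.isProbabilityMeasure
  -- the maximal factor of the extension, chosen to contain the algebras of all other coordinates
  obtain ⟨Ξ', hΞ', -, hb⟩ := exists_isMaximalClassFactor_join (liftSystem hν i)
    (fun j : {j : Fin d // j ≠ i} => diffSubgroup i j)
    (fun j n => (fun x : Fin d → X.carrier => x j) ⁻¹'
      MeasurableSpace.natGeneratingSequence X.carrier n)
    (fun j n => measurableSet_invariantFactor_liftSystem hν j.2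
      (MeasurableSpace.measurableSet_natGeneratingSequence n))
  have hcoord : ∀ j, j ≠ i → coordAlgebra X j X.measurableSpace ≤ Ξ' := fun j hj => by
    rw [coordAlgebra, ← MeasurableSpace.generateFrom_natGeneratingSequence X.carrier,
      MeasurableSpace.comap_generateFrom]
    refine MeasurableSpace.generateFrom_le ?_
    rintro _ ⟨_, ⟨n, rfl⟩, rfl⟩
    exact hb ⟨j, hj⟩ n
  have hG : StronglyMeasurable[Ξ'] fun x => ∏ j ∈ Finset.univ.erase i, F j x :=
    Finset.stronglyMeasurable_fun_prod _ fun j hj =>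
      (hF j).mono (hcoord j (Finset.ne_of_mem_erase hj))
  have hGb : MemLp (fun x => ∏ j ∈ Finset.univ.erase i, F j x) ⊤ ν := by
    have := MemLp.prod' (s := Finset.univ.erase i) (p := fun _ => ⊤) (f := F) fun j _ => hFb j
    simpa using this
  have hle : coordAlgebra X i (pairJoin X i) ≤ MeasurableSpace.pi :=
    (MeasurableSpace.comap_mono (pairJoin_le X i)).trans (coordAlgebra_le X i)
  have htower : ∀ m ≤ coordAlgebra X i (pairJoin X i), ν[D | m] =ᵐ[ν] 0 := fun m hm => by
    refine (condExp_condExp_of_le hm hle).symm.trans ((condExp_congr_ae hD0).trans ?_)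
    rw [condExp_zero]
  obtain ⟨Ξ, hΞ, hΞle, -⟩ := exists_isMaximalClassFactor_join X
    (fun j : {j : Fin d // j ≠ i} => diffSubgroup i j) (fun _ _ => ∅)
    (fun j _ => @MeasurableSet.empty _ (invariantFactor X (diffSubgroup i j)))
  have hsat := hX (liftSystem hν i) _ (isFactorMap_liftSystem hν i) Ξ' Ξ hΞ' hΞ
    ![D, fun x => ∏ j ∈ Finset.univ.erase i, F j x]
    (by
      intro k
      fin_cases k
      · exact hD
      · exact hG)
    (by
      intro k
      fin_cases k
      · exact hDb
      · exact hGb)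
  simp only [Fin.prod_univ_two, Matrix.cons_val_zero, Matrix.cons_val_one] at hsat
  refine hsat.trans (integral_eq_zero_of_ae ?_)
  filter_upwards [htower _ (MeasurableSpace.comap_mono hΞle)] with x hx
  exact mul_eq_zero_of_left hx _

/-- A sated system's self-joining is relatively independent over its characteristic factors: the
difference between a function and its conditional expectation has vanishing conditional
expectation, so `integral_mul_prod_eq_zero` applies to it. -/
theorem relIndep_of_isSated (hν : IsFurstenbergSelfJoining X ν)
    (hX : ∀ i : Fin d, IsSated (classC.{u} i) X) :
    RelIndep ν (fun i => coordAlgebra X i X.measurableSpace)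
      (fun i => coordAlgebra X i (pairJoin X i)) := by
  classical
  have := hν.isProbabilityMeasure
  intro f hf hfb
  have hle : ∀ i, coordAlgebra X i (pairJoin X i) ≤ coordAlgebra X i X.measurableSpace := fun i =>
    MeasurableSpace.comap_mono (pairJoin_le X i)
  let E : Fin d → (Fin d → X.carrier) → ℝ := fun i => ν[f i | coordAlgebra X i (pairJoin X i)]
  have hE : ∀ i, StronglyMeasurable[coordAlgebra X i X.measurableSpace] (E i) := fun i =>
    stronglyMeasurable_condExp.mono (hle i)
  have hEb : ∀ i, MemLp (E i) ⊤ ν := fun i => (hfb i).condExp le_top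
  -- replace the functions by their conditional expectations one at a time
  suffices h : ∀ s : Finset (Fin d), ∫ x, ∏ i, f i x ∂ν =
      ∫ x, ∏ i, (if i ∈ s then E i else f i) x ∂ν by
    simpa only [Finset.mem_univ, if_true] using h Finset.univ
  intro s
  induction s using Finset.induction_on with
  | empty => simp
  | insert i s hi ih =>
    rw [ih, ← sub_eq_zero]
    let F : Fin d → (Fin d → X.carrier) → ℝ := fun j => if j ∈ s then E j else f j
    let F' : Fin d → (Fin d → X.carrier) → ℝ := fun j => if j ∈ insert i s then E j else f j
    have hF : ∀ j, StronglyMeasurable[coordAlgebra X j X.measurableSpace] (F j) := fun j => by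
      by_cases hj : j ∈ s
      · simpa [F, hj] using hE j
      · simpa [F, hj] using hf j
    have hFb : ∀ j, MemLp (F j) ⊤ ν := fun j => by
      by_cases hj : j ∈ s
      · simpa [F, hj] using hEb j
      · simpa [F, hj] using hfb j
    have hFb' : ∀ j, MemLp (F' j) ⊤ ν := fun j => by
      by_cases hj : j ∈ insert i s
      · simpa only [F', hj, if_true] using hEb j
      · simpa only [F', hj, if_false] using hfb j
    have hint : ∀ H : Fin d → (Fin d → X.carrier) → ℝ, (∀ j, MemLp (H j) ⊤ ν) →
        Integrable (fun x => ∏ j, H j x) ν := fun H hH => by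
      have h := MemLp.prod' (s := Finset.univ) (p := fun _ => ⊤) (f := H) fun j _ => hH j
      simp only [ENNReal.inv_top, Finset.sum_const_zero, ENNReal.inv_zero] at h
      exact h.integrable le_top
    change ∫ x, ∏ j, F j x ∂ν - ∫ x, ∏ j, F' j x ∂ν = 0
    rw [← integral_sub (hint F hFb) (hint F' hFb')]
    have hfi : Integrable (f i) ν := (hfb i).integrable le_top
    have hEi : Integrable (E i) ν := integrable_condExp
    rw [← integral_mul_prod_eq_zero hν i (hX i) ((hf i).sub (hE i)) ((hfb i).sub (hEb i)) ?_ hF hFb]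
    · refine integral_congr_ae (Eventually.of_forall fun x => ?_)
      have h1 : ∏ j ∈ Finset.univ.erase i, F' j x = ∏ j ∈ Finset.univ.erase i, F j x := by
        refine Finset.prod_congr rfl fun j hj => ?_
        simp [F, F', Finset.ne_of_mem_erase hj]
      have h2 : F i = f i := if_neg hi
      have h3 : F' i = E i := if_pos (Finset.mem_insert_self i s)
      change ∏ j, F j x - ∏ j, F' j x = (f i x - E i x) * _
      rw [← Finset.mul_prod_erase _ _ (Finset.mem_univ i),
        ← Finset.mul_prod_erase _ (fun j => F' j x) (Finset.mem_univ i), h1, h2, h3, sub_mul]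
    · refine (condExp_sub hfi hEi _).trans ?_
      have h4 : ν[E i | coordAlgebra X i (pairJoin X i)] =ᵐ[ν] E i :=
        condExp_condExp_of_le le_rfl ((hle i).trans (coordAlgebra_le X i))
      filter_upwards [h4] with x hx
      simp only [Pi.sub_apply, hx, Pi.zero_apply]
      exact sub_self _

/-! ### The two descriptions of the characteristic factors -/

theorem invariantFactor_anti (X : PPSystem.{u} (Fin d → ℤ)) {Λ Λ' : AddSubgroup (Fin d → ℤ)}
    (h : Λ ≤ Λ') : invariantFactor X Λ' ≤ invariantFactor X Λ :=
  fun _ hA => ⟨hA.1, fun γ hγ => hA.2 γ (h hγ)⟩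

theorem pairJoin_eq_PhiPrincipal (X : PPSystem.{u} (Fin d → ℤ)) (i : Fin d) :
    pairJoin X i = PhiPrincipal X i := by
  refine le_antisymm (iSup_le fun j => ?_) (iSup_le fun e => ?_)
  · have hcard : 2 ≤ ({i, j.1} : Finset (Fin d)).card := (Finset.card_pair j.2.symm).ge
    refine le_trans ?_ (le_iSup (fun e : {e : Finset (Fin d) // 2 ≤ e.card ∧ i ∈ e} => Phi X e)
      ⟨{i, j.1}, hcard, by simp⟩)
    refine invariantFactor_anti X ((AddSubgroup.closure_le _).2 ?_)
    have hmem : stdVec i - stdVec j.1 ∈ diffSubgroup i j.1 :=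
      AddSubgroup.mem_zmultiples _
    rintro _ ⟨a, ha, b, hb, rfl⟩
    simp only [Finset.mem_insert, Finset.mem_singleton] at ha hb
    rcases ha with rfl | rfl <;> rcases hb with rfl | rfl
    · simp
    · exact hmem
    · rw [← neg_sub]
      exact neg_mem hmem
    · simp
  · obtain ⟨j, hj, hji⟩ := Finset.exists_mem_ne e.2.1 i
    refine le_trans ?_ (le_iSup (fun j : {j : Fin d // j ≠ i} => invariantFactor X (diffSubgroup i j))
      ⟨j, hji⟩)
    refine invariantFactor_anti X ((AddSubgroup.zmultiples_le_of_mem) ?_)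
    exact AddSubgroup.subset_closure ⟨i, e.2.2, j, hj, rfl⟩

end Satedness

theorem mainTheorem9 (d : ℕ) (hd : 1 ≤ d) (X : Satedness.PPSystem.{u} (Fin d → ℤ))
    (hX : ∀ i : Fin d, Satedness.IsSated (Satedness.classC.{u} i) X) :
    (∃! μF : Measure (Fin d → X.carrier), Satedness.IsFurstenbergSelfJoining X μF) ∧
    (∀ i : Fin d, Satedness.pairJoin X i = Satedness.PhiPrincipal X i) ∧
    (∀ μF : Measure (Fin d → X.carrier), Satedness.IsFurstenbergSelfJoining X μF →
      Satedness.RelIndep μF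
        (fun i => Satedness.coordAlgebra X i X.measurableSpace)
        (fun i => Satedness.coordAlgebra X i (Satedness.pairJoin X i))) := by
  obtain ⟨ν, hν⟩ := Satedness.exists_isFurstenbergSelfJoining X
  exact ⟨⟨ν, hν, fun ν' hν' => hν'.unique hν⟩, Satedness.pairJoin_eq_PhiPrincipal X,
    fun μF hμF => Satedness.relIndep_of_isSated hμF hX⟩
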